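/- A non-quasianalytic weight function is a continuous increasing (i.e. non-decreasing) function $\omega:[0,\infty)\to[0,\infty)$ such that ($\alpha$) there is $L>0$ with $\omega(2t)\le L(\omega(t)+1)$ for all $t\ge0$; ($\beta$) $\int_1^{\infty}\omega(t)t^{-2}\,dt<\infty$; ($\gamma$) there are $a\in\mathbb R$, $b>0$ with $\omega(t)\ge a+b\log(1+t)$ for all $t\ge 0$; ($\delta$) $\varphi(t)=\omega(e^t)$ is convex on $\mathbb R$. Write $\omega(x)=\omega(|x|)$ for $x\in\mathbb R^n$, and $\varphi^*(s)=\sup_{t\ge0}(st-\varphi(t))\in(-\infty,+\infty]$ for $s\ge0$, with $e^{-\infty}=0$. Put $D^\alpha=(-i)^{|\alpha|}\partial^\alpha$, $|\alpha|=\alpha_1+\dots+\alpha_n$ and $\widehat u(\xi)=\int_{\mathbb R^n}e^{-i\langle x,\xi\rangle}u(x)\,dx$. Let $\mathcal S_\omega(\mathbb R^n)$ be the set of all $u\in L^1(\mathbb R^n)$ with $u,\widehat u\in C^\infty(\mathbb R^n)$ and, for all $\lambda>0$ and $\alpha\in\mathbb N_0^n$, $\sup_x e^{\lambda\omega(x)}|D^\alpha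 u(x)|<\infty$ and $\sup_\xi e^{\lambda\omega(\xi)}|D^\alpha\widehat u(\xi)|<\infty$. **Theorem.** Let $\omega$ be a non-quasianalytic weight function and $u\in\mathcal S(\mathbb R^n)$. Then $u\in\mathcal S_\omega(\mathbb R^n)$ if and only if one of the following equivalent conditions holds: 1. for all $\lambda>0$, $\alpha\in\mathbb N_0^n$: $\sup_x e^{\lambda\omega(x)}|D^\alpha u(x)|<\infty$ and $\sup_\xi e^{\lambda\omega(\xi)}|D^\alpha\widehat u(\xi)|<\infty$; 2. for all $\lambda>0$, $\alpha\in\mathbb N_0^n$: $\sup_x e^{\lambda\omega(x)}|x^\alpha u(x)|<\infty$ and $\sup_\xi e^{\lambda\omega(\xi)}|\xi^\alpha\widehat u(\xi)|<\infty$; 3. for all $\lambda>0$: $\sup_x e^{\lambda\omega(x)}|u(x)|<\infty$ and $\sup_\xi e^{\lambda\omega(\xi)}|\widehat u(\xi)|<\infty$; 4. (a) for all $\beta\in\mathbb N_0^n$, $\lambda>0$ there is $C_{\beta,\lambda}>0$ with $\sup_x|x^\beta D^\alpha u(x)|\,e^{-\lambda\varphi^*(|\alpha|/\lambda)}\le C_{\beta,\lambda}$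 for all $\alpha\in\mathbb N_0^n$, and (b) for all $\alpha\in\mathbb N_0^n$, $\mu>0$ there is $C_{\alpha,\mu}>0$ with $\sup_x|x^\beta D^\alpha u(x)|\,e^{-\mu\varphi^*(|\beta|/\mu)}\le C_{\alpha,\mu}$ for all $\beta\in\mathbb N_0^n$; 5. for all $\mu,\lambda>0$ there is $C_{\mu,\lambda}>0$ with $\sup_x|x^\beta D^\alpha u(x)|\,e^{-\lambda\varphi^*(|\alpha|/\lambda)}e^{-\mu\varphi^*(|\beta|/\mu)}\le C_{\mu,\lambda}$ for all $\alpha,\beta\in\mathbb N_0^n$; 6. for all $\lambda>0$ there is $C_\lambda>0$ with $\sup_x|x^\beta D^\alpha u(x)|\,e^{-\lambda\varphi^*(|\alpha+\beta|/\lambda)}\le C_\lambda$ for all $\alpha,\beta\in\mathbb N_0^n$. Moreover, each of the six conditions gives a family of seminorms: the suprema in (1), (2), (3), indexed by their parameters, for $u$ and for $\widehat u$; $\sup_\alpha\sup_x$ of the expression in (4)(a), for all $\beta,\lambda$, together with $\sup_\beta\sup_x$ of the expression in (4)(b), for all $\alpha,\mu$; and $\sup_{\alpha,\beta}\sup_x$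 of the expressions in (5), for all $\lambda,\mu$, and in (6), for all $\lambda$. All these seminorms are finite on $\mathcal S_\omega(\mathbb R^n)$, and the six families are equivalent there: each seminorm of one family is bounded on $\mathcal S_\omega(\mathbb R^n)$ by a constant times the maximum of finitely many seminorms of any other family. -/

import Mathlib

open scoped ENNReal NNReal SchwartzMap

noncomputable section

namespace SOmega

/-- The Euclidean space `ℝⁿ`. -/
abbrev E (n : ℕ) : Type := EuclideanSpace ℝ (Fin n)

/-- Non-quasianalytic weight functions `ω : [0,∞) → [0,∞)`; only the values of `ω` on `[0,∞)`
are used. -/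
structure IsWeight (ω : ℝ → ℝ) : Prop where
  continuousOn : ContinuousOn ω (Set.Ici 0)
  monotoneOn : MonotoneOn ω (Set.Ici 0)
  nonneg : ∀ t, 0 ≤ t → 0 ≤ ω t
  alpha : ∃ L : ℝ, 0 < L ∧ ∀ t, 0 ≤ t → ω (2 * t) ≤ L * (ω t + 1)
  beta : MeasureTheory.IntegrableOn (fun t => ω t / t ^ 2) (Set.Ioi 1)
  gamma : ∃ a b : ℝ, 0 < b ∧ ∀ t, 0 ≤ t → a + b * Real.log (1 + t) ≤ ω t
  delta : ConvexOn ℝ Set.univ (fun t => ω (Real.exp t))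

/-- The Young conjugate `φ*(s) = sup_{t ≥ 0} (s t - φ(t))` of `φ(t) = ω(e^t)`, which may be `+∞`. -/
def youngConj (ω : ℝ → ℝ) (s : ℝ) : EReal :=
  ⨆ (t : ℝ) (_ : 0 ≤ t), ((s * t - ω (Real.exp t) : ℝ) : EReal)

/-- The factor `exp(-lam φ*(k / lam))`, which is `0` where `φ*(k / lam) = +∞`. -/
def youngFactor (ω : ℝ → ℝ) (lam : ℝ) (k : ℕ) : ℝ≥0∞ :=
  EReal.exp (-((lam : EReal) * youngConj ω (k / lam)))

variable {n : ℕ}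

/-- The length `|α| = α₁ + ⋯ + αₙ` of a multi-index. -/
def len (α : Fin n → ℕ) : ℕ := ∑ j, α j

/-- The monomial `x^β`. -/
def mono (β : Fin n → ℕ) (x : E n) : ℝ := ∏ j, x j ^ β j

/-- `D_j = -i ∂_j`. -/
def Dj (j : Fin n) (f : E n → ℂ) : E n → ℂ :=
  fun x => -Complex.I * lineDeriv ℝ f x (EuclideanSpace.single j 1)

/-- `D^α = D_1^{α₁} ⋯ D_n^{αₙ}`. -/
def D (α : Fin n → ℕ) (f : E n → ℂ) : E n → ℂ :=
  (List.finRange n).foldr (fun j g => (Dj j)^[α j] g) f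

/-- The Fourier transform `û(ξ) = ∫ e^{-i⟨x,ξ⟩} u(x) dx`. -/
def hat (u : E n → ℂ) : E n → ℂ :=
  fun ξ => ∫ x : E n, Complex.exp (-Complex.I * ((inner ℝ x ξ : ℝ) : ℂ)) * u x

/-- `sup_x e^{lam ω(x)} |f(x)|`, where `ω(x) = ω(|x|)`. -/
def expSup (ω : ℝ → ℝ) (lam : ℝ) (f : E n → ℂ) : ℝ≥0∞ :=
  ⨆ x : E n, ENNReal.ofReal (Real.exp (lam * ω ‖x‖)) * ‖f x‖ₑ

/-- `x ↦ x^β f(x)`. -/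
def mulMono (β : Fin n → ℕ) (f : E n → ℂ) : E n → ℂ := fun x => (mono β x : ℂ) * f x

/-- The space `S_ω(ℝⁿ)`. -/
def Space (n : ℕ) (ω : ℝ → ℝ) : Set (E n → ℂ) :=
  {u | MeasureTheory.Integrable u ∧
    ContDiff ℝ ((⊤ : ℕ∞) : WithTop ℕ∞) u ∧ ContDiff ℝ ((⊤ : ℕ∞) : WithTop ℕ∞) (hat u) ∧
    (∀ lam : ℝ, 0 < lam → ∀ α : Fin n → ℕ, expSup ω lam (D α u) < ∞) ∧
    (∀ lam : ℝ, 0 < lam → ∀ α : Fin n → ℕ, expSup ω lam (D α (hat u)) < ∞)}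

/-! The six conditions. -/

def Cond1 (ω : ℝ → ℝ) (u : E n → ℂ) : Prop :=
  (∀ lam : ℝ, 0 < lam → ∀ α : Fin n → ℕ, expSup ω lam (D α u) < ∞) ∧
  (∀ lam : ℝ, 0 < lam → ∀ α : Fin n → ℕ, expSup ω lam (D α (hat u)) < ∞)

def Cond2 (ω : ℝ → ℝ) (u : E n → ℂ) : Prop :=
  (∀ lam : ℝ, 0 < lam → ∀ α : Fin n → ℕ, expSup ω lam (mulMono α u) < ∞) ∧
  (∀ lam : ℝ, 0 < lam → ∀ α : Fin n → ℕ, expSup ω lam (mulMono α (hat u)) < ∞)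

def Cond3 (ω : ℝ → ℝ) (u : E n → ℂ) : Prop :=
  (∀ lam : ℝ, 0 < lam → expSup ω lam u < ∞) ∧
  (∀ lam : ℝ, 0 < lam → expSup ω lam (hat u) < ∞)

def Cond4 (ω : ℝ → ℝ) (u : E n → ℂ) : Prop :=
  (∀ β : Fin n → ℕ, ∀ lam : ℝ, 0 < lam → ∃ C : ℝ, 0 < C ∧ ∀ α : Fin n → ℕ,
    ⨆ x : E n, ‖mulMono β (D α u) x‖ₑ * youngFactor ω lam (len α) ≤ ENNReal.ofReal C) ∧
  (∀ α : Fin n → ℕ, ∀ mu : ℝ, 0 < mu → ∃ C : ℝ, 0 < C ∧ ∀ β : Fin n → ℕ,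
    ⨆ x : E n, ‖mulMono β (D α u) x‖ₑ * youngFactor ω mu (len β) ≤ ENNReal.ofReal C)

def Cond5 (ω : ℝ → ℝ) (u : E n → ℂ) : Prop :=
  ∀ mu lam : ℝ, 0 < mu → 0 < lam → ∃ C : ℝ, 0 < C ∧ ∀ α β : Fin n → ℕ,
    ⨆ x : E n, ‖mulMono β (D α u) x‖ₑ * youngFactor ω lam (len α) * youngFactor ω mu (len β)
      ≤ ENNReal.ofReal C

def Cond6 (ω : ℝ → ℝ) (u : E n → ℂ) : Prop :=
  ∀ lam : ℝ, 0 < lam → ∃ C : ℝ, 0 < C ∧ ∀ α β : Fin n → ℕ,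
    ⨆ x : E n, ‖mulMono β (D α u) x‖ₑ * youngFactor ω lam (len (α + β)) ≤ ENNReal.ofReal C

/-! The families of seminorms that belong to the six conditions, as `[0,∞]`-valued functionals. -/

def Fam1 (n : ℕ) (ω : ℝ → ℝ) : Set ((E n → ℂ) → ℝ≥0∞) :=
  {p | ∃ lam : ℝ, 0 < lam ∧ ∃ α : Fin n → ℕ,
    p = (fun u => expSup ω lam (D α u)) ∨ p = (fun u => expSup ω lam (D α (hat u)))}

def Fam2 (n : ℕ) (ω : ℝ → ℝ) : Set ((E n → ℂ) → ℝ≥0∞) :=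
  {p | ∃ lam : ℝ, 0 < lam ∧ ∃ α : Fin n → ℕ,
    p = (fun u => expSup ω lam (mulMono α u)) ∨ p = (fun u => expSup ω lam (mulMono α (hat u)))}

def Fam3 (n : ℕ) (ω : ℝ → ℝ) : Set ((E n → ℂ) → ℝ≥0∞) :=
  {p | ∃ lam : ℝ, 0 < lam ∧
    (p = (fun u => expSup ω lam u) ∨ p = (fun u => expSup ω lam (hat u)))}

def Fam4 (n : ℕ) (ω : ℝ → ℝ) : Set ((E n → ℂ) → ℝ≥0∞) :=
  {p | ∃ lam : ℝ, 0 < lam ∧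
    ((∃ β : Fin n → ℕ, p = fun u =>
      ⨆ (α : Fin n → ℕ) (x : E n), ‖mulMono β (D α u) x‖ₑ * youngFactor ω lam (len α)) ∨
    (∃ α : Fin n → ℕ, p = fun u =>
      ⨆ (β : Fin n → ℕ) (x : E n), ‖mulMono β (D α u) x‖ₑ * youngFactor ω lam (len β)))}

def Fam5 (n : ℕ) (ω : ℝ → ℝ) : Set ((E n → ℂ) → ℝ≥0∞) :=
  {p | ∃ mu lam : ℝ, 0 < mu ∧ 0 < lam ∧ p = fun u =>
    ⨆ (α : Fin n → ℕ) (β : Fin n → ℕ) (x : E n),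
      ‖mulMono β (D α u) x‖ₑ * youngFactor ω lam (len α) * youngFactor ω mu (len β)}

def Fam6 (n : ℕ) (ω : ℝ → ℝ) : Set ((E n → ℂ) → ℝ≥0∞) :=
  {p | ∃ lam : ℝ, 0 < lam ∧ p = fun u =>
    ⨆ (α : Fin n → ℕ) (β : Fin n → ℕ) (x : E n),
      ‖mulMono β (D α u) x‖ₑ * youngFactor ω lam (len (α + β))}

def Fam (n : ℕ) (ω : ℝ → ℝ) : Fin 6 → Set ((E n → ℂ) → ℝ≥0∞) :=
  ![Fam1 n ω, Fam2 n ω, Fam3 n ω, Fam4 n ω, Fam5 n ω, Fam6 n ω]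

/-- On `S`, every member of `P` is bounded by a constant times the maximum of finitely many
members of `Q`. -/
def DominatedOn (S : Set (E n → ℂ)) (P Q : Set ((E n → ℂ) → ℝ≥0∞)) : Prop :=
  ∀ p ∈ P, ∃ T : Finset ((E n → ℂ) → ℝ≥0∞), (T : Set ((E n → ℂ) → ℝ≥0∞)) ⊆ Q ∧
    ∃ C : ℝ≥0, ∀ u ∈ S, p u ≤ C * T.sup (fun q => q u)

end SOmega

end

noncomputable section
namespace SOmega

/-! ### Weight functions -/

section Weight

variable {ω : ℝ → ℝ}

/-! The substitution r = e^t turns e^{-λφ*(k/λ)} into `yf ω λ k`, the infimum of e^{λω(r)} r^{-k}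
over r ≥ 1. So r^k `yf` ≤ e^{λω(r)} for r ≥ 1, and convexity (δ) supplies a converse: for each t
some single k gives e^{λω(t)} ≤ C t^k `yf ω μ k` (`exp_le_pow_mul_yf`). These two inequalities trade
powers for exponentials. All families of seminorms are compared on Schwartz functions, with (3) as
the hub; finiteness, hence the equivalence of the conditions, follows from the seminorm estimates.

(3) controls (1): decay of û bounds every derivative of u. A Landau-type interpolation between the
decay of g and the boundedness of its second derivative makes the first derivative decay
(`expBound_Dop`), and induction gives all orders (`expBound_Dw`).

(3) controls (5), the main step (`norm_Xw_Dw_mul_yf_le`): decay of u bounds x^b u in L¹, decay of û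
bounds D^a u in the sup norm, each with the right factor, hence also the pairing ⟨x^b u, D^a u⟩. For
a word w in the operators x_j and D_j, self-adjointness gives ‖wu‖² = ⟨w* w u, u⟩. Moving each D_j
to the right-hand argument reduces this to such pairings. Every move yields one main term and one
commutator term with an integer coefficient (`norm_ip_word_le`). The coefficients are absorbed by
the variant `yft`, which satisfies (k+1) `yft`(k+1) ≤ `yft`(k). Since (β) makes ω(t) = o(t), `yf` is
at most C 6^k `yft`, and geometric factors are harmless by (α). A Sobolev inequality returns from L²
to the sup norm.

(5) and (6) differ only by the sub- and supermultiplicativity of `yf`; (4) is (5) with one index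
frozen. (4) controls (3) by the converse inequality above, applied to u directly and to û through
|ξ^α û| ≤ ‖D^α u‖₁. Finally, elements of the space are Schwartz functions (`exists_schwartz`), so
the estimates hold on it. -/

lemma IsWeight.mono_le (hω : IsWeight ω) {s t : ℝ} (hs : 0 ≤ s) (h : s ≤ t) : ω s ≤ ω t :=
  hω.monotoneOn (Set.mem_Ici.2 hs) (Set.mem_Ici.2 (hs.trans h)) h

/-- Condition (β) with monotonicity forces ω(t) = o(t): the tail integral beyond t is at least
ω(t)/(4t). -/
lemma IsWeight.le_linear (hω : IsWeight ω) {ε : ℝ} (hε : 0 < ε) :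
    ∃ C : ℝ, 0 ≤ C ∧ ∀ t, 0 ≤ t → ω t ≤ ε * t + C := by
  have h1 := MeasureTheory.tendsto_setIntegral_of_antitone (μ := MeasureTheory.volume)
    (f := fun t => ω t / t ^ 2) (s := fun T : ℝ => Set.Ioi T) (fun _ => measurableSet_Ioi)
    (fun _ _ h => Set.Ioi_subset_Ioi h) ⟨1, hω.beta⟩
  have h2 : ⋂ T : ℝ, Set.Ioi T = ∅ := by
    ext x
    simp only [Set.mem_iInter, Set.mem_Ioi, Set.mem_empty_iff_false, iff_false, not_forall]
    exact ⟨x, lt_irrefl x⟩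
  rw [h2] at h1
  simp only [MeasureTheory.Measure.restrict_empty, MeasureTheory.integral_zero_measure] at h1
  obtain ⟨T, hT⟩ := Filter.eventually_atTop.1
    (h1.eventually (gt_mem_nhds (by positivity : (0 : ℝ) < ε / 4)))
  set T₀ := max T 1 with hT₀
  have hT1 : 1 ≤ T₀ := le_max_right _ _
  refine ⟨ω T₀, hω.nonneg _ (by linarith), fun t ht => ?_⟩
  rcases le_total t T₀ with h | h
  · have := hω.mono_le ht h
    nlinarith [mul_nonneg hε.le ht]
  · have ht1 : 1 ≤ t := hT1.trans h
    have h3 := hT t ((le_max_left _ _).trans h)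
    have hint : MeasureTheory.IntegrableOn (fun s => ω s / s ^ 2) (Set.Ioi t) :=
      hω.beta.mono_set (Set.Ioi_subset_Ioi ht1)
    -- On (t, 2t] the integrand is at least ω(t)/(2t)², and the interval has length t.
    have h4 : ω t / (4 * t ^ 2) * MeasureTheory.volume.real (Set.Ioc t (2 * t)) ≤
        ∫ s in Set.Ioc t (2 * t), ω s / s ^ 2 := by
      apply MeasureTheory.setIntegral_ge_of_const_le_real measurableSet_Ioc (by simp)
      · intro s hs
        have hs0 : 0 < s := by linarith [hs.1]
        have := hω.mono_le ht hs.1.le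
        have h0 := hω.nonneg t ht
        apply div_le_div₀ (h0.trans this) this (by positivity)
        nlinarith [hs.1, hs.2]
      · exact hint.mono_set Set.Ioc_subset_Ioi_self
    have h5 : ∫ s in Set.Ioc t (2 * t), ω s / s ^ 2 ≤ ∫ s in Set.Ioi t, ω s / s ^ 2 := by
      apply MeasureTheory.setIntegral_mono_set hint _ Set.Ioc_subset_Ioi_self.eventuallyLE
      filter_upwards [MeasureTheory.ae_restrict_mem measurableSet_Ioi] with s hs
      have hs0 : 0 < s := by linarith [Set.mem_Ioi.1 hs]
      exact div_nonneg (hω.nonneg s hs0.le) (by positivity)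
    have h6 : MeasureTheory.volume.real (Set.Ioc t (2 * t)) = t := by
      rw [Real.volume_real_Ioc_of_le (by linarith)]; ring
    rw [h6] at h4
    have h7 : ω t / (4 * t ^ 2) * t = ω t / (4 * t) := by
      field_simp
    rw [h7] at h4
    have h8 : ω t / (4 * t) < ε / 4 := by linarith
    rw [div_lt_iff₀ (by positivity)] at h8
    have := hω.nonneg T₀ (by linarith)
    linarith

lemma IsWeight.dilation (hω : IsWeight ω) (A : ℝ) (hA : 0 ≤ A) :
    ∃ L : ℝ, 0 < L ∧ ∀ t, 0 ≤ t → ω (A * t) ≤ L * (ω t + 1) := by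
  obtain ⟨L, hL, h⟩ := hω.alpha
  have key : ∀ m : ℕ, ∃ L' : ℝ, 0 < L' ∧ ∀ t, 0 ≤ t → ω (2 ^ m * t) ≤ L' * (ω t + 1) := by
    intro m
    induction m with
    | zero => exact ⟨1, one_pos, fun t _ => by simp⟩
    | succ m ih =>
      obtain ⟨L', hL', ih⟩ := ih
      refine ⟨L * (L' + 1), by positivity, fun t ht => ?_⟩
      have h1 := h (2 ^ m * t) (by positivity)
      have h2 := ih t ht
      have h3 := hω.nonneg t ht
      rw [pow_succ', mul_assoc]
      calc _ ≤ L * (ω (2 ^ m * t) + 1) := h1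
        _ ≤ L * (L' * (ω t + 1) + (ω t + 1)) := by gcongr; linarith
        _ = _ := by ring
  obtain ⟨m, hm⟩ := pow_unbounded_of_one_lt A (one_lt_two)
  obtain ⟨L', hL', h'⟩ := key m
  exact ⟨L', hL', fun t ht =>
    (hω.mono_le (by positivity) (by gcongr)).trans (h' t ht)⟩

lemma IsWeight.exp_dilation (hω : IsWeight ω) (A : ℝ) (hA : 0 ≤ A) {lam : ℝ} (hlam : 0 < lam) :
    ∃ lam' C : ℝ, 0 < lam' ∧ 0 < C ∧ ∀ t, 0 ≤ t →
      Real.exp (lam * ω (A * t)) ≤ C * Real.exp (lam' * ω t) := by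
  obtain ⟨L, hL, h⟩ := hω.dilation A hA
  refine ⟨lam * L, Real.exp (lam * L), by positivity, Real.exp_pos _, fun t ht => ?_⟩
  rw [← Real.exp_add]
  apply Real.exp_le_exp.2
  have := mul_le_mul_of_nonneg_left (h t ht) hlam.le
  linarith

/-- For t ≥ 1 the shift is dominated by doubling, t + 1 ≤ 2t; for t ≤ 1 the constant e^{λω(2)}
suffices. -/
lemma IsWeight.exp_shift (hω : IsWeight ω) {lam : ℝ} (hlam : 0 < lam) :
    ∃ lam' C : ℝ, 0 < lam' ∧ 0 < C ∧ ∀ t, 0 ≤ t →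
      Real.exp (lam * ω (t + 1)) ≤ C * Real.exp (lam' * ω t) := by
  obtain ⟨lam', C, h1, h2, h3⟩ := hω.exp_dilation 2 zero_le_two hlam
  refine ⟨lam', C + Real.exp (lam * ω 2), h1, by positivity, fun t ht => ?_⟩
  have h4 : 1 ≤ Real.exp (lam' * ω t) :=
    Real.one_le_exp (mul_nonneg h1.le (hω.nonneg t ht))
  rcases le_total 1 t with h | h
  · calc _ ≤ Real.exp (lam * ω (2 * t)) := by
          gcongr; exact hω.mono_le (by linarith) (by linarith)
      _ ≤ C * Real.exp (lam' * ω t) := h3 t ht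
      _ ≤ _ := by gcongr; linarith [Real.exp_pos (lam * ω 2)]
  · calc _ ≤ Real.exp (lam * ω 2) * 1 := by
          rw [mul_one]; gcongr; exact hω.mono_le (by linarith) (by linarith)
      _ ≤ Real.exp (lam * ω 2) * Real.exp (lam' * ω t) := by gcongr
      _ ≤ _ := by gcongr; linarith

lemma IsWeight.pow_le_exp (hω : IsWeight ω) (N : ℕ) :
    ∃ c C : ℝ, 0 < c ∧ 0 < C ∧ ∀ t, 0 ≤ t → (1 + t) ^ N ≤ C * Real.exp (c * ω t) := by
  obtain ⟨a, b, hb, h⟩ := hω.gamma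
  refine ⟨(N + 1) / b, Real.exp (-((N + 1) / b * a)), by positivity, Real.exp_pos _,
    fun t ht => ?_⟩
  have h1 : (1 + t) ^ N ≤ (1 + t) ^ (N + 1) := pow_le_pow_right₀ (by linarith) (by simp)
  refine h1.trans ?_
  have h2 : (1 + t) ^ (N + 1) = Real.exp (((N + 1 : ℕ) : ℝ) * Real.log (1 + t)) := by
    rw [mul_comm, ← Real.rpow_def_of_pos (by linarith), Real.rpow_natCast]
  rw [h2, ← Real.exp_add]
  apply Real.exp_le_exp.2
  have h3 : (N + 1) / b * (a + b * Real.log (1 + t)) ≤ (N + 1) / b * ω t := by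
    gcongr; exact h t ht
  have h4 : ((N : ℝ) + 1) / b * (a + b * Real.log (1 + t)) =
      (N + 1) / b * a + (N + 1) * Real.log (1 + t) := by field_simp
  push_cast
  linarith

/-! ### The real form of the Young factor -/

/-- `inf_{r ≥ 1} e^{lam ω(r)} r^{-k}`. -/
def yf (ω : ℝ → ℝ) (lam : ℝ) (k : ℕ) : ℝ :=
  ⨅ r : Set.Ici (1 : ℝ), Real.exp (lam * ω r) / (r : ℝ) ^ k

instance : Nonempty (Set.Ici (1 : ℝ)) := ⟨⟨1, Set.mem_Ici.2 le_rfl⟩⟩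

lemma yf_bddBelow (ω : ℝ → ℝ) (lam : ℝ) (k : ℕ) :
    BddBelow (Set.range fun r : Set.Ici (1 : ℝ) => Real.exp (lam * ω r) / (r : ℝ) ^ k) := by
  refine ⟨0, ?_⟩
  rintro _ ⟨r, rfl⟩
  have : (1 : ℝ) ≤ r := r.2
  positivity

lemma yf_le (ω : ℝ → ℝ) (lam : ℝ) (k : ℕ) {r : ℝ} (hr : 1 ≤ r) :
    yf ω lam k ≤ Real.exp (lam * ω r) / r ^ k :=
  ciInf_le (yf_bddBelow ω lam k) ⟨r, hr⟩

lemma le_yf {lam : ℝ} {k : ℕ} {c : ℝ}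
    (h : ∀ r : ℝ, 1 ≤ r → c ≤ Real.exp (lam * ω r) / r ^ k) : c ≤ yf ω lam k :=
  le_ciInf fun r => h r r.2

lemma yf_nonneg (ω : ℝ → ℝ) (lam : ℝ) (k : ℕ) : 0 ≤ yf ω lam k :=
  le_yf fun r hr => by positivity

/-- Substitute r = e^t, so that t ≥ 0 corresponds to r ≥ 1. Where φ* is infinite, both sides vanish.
-/
lemma youngFactor_eq {lam : ℝ} (hlam : 0 < lam) (k : ℕ) :
    youngFactor ω lam k = ENNReal.ofReal (yf ω lam k) := by
  have hcoe : ∀ t : ℝ, (k / lam * t - ω (Real.exp t)) =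
      -((lam * ω (Real.exp t) - k * t) / lam) := fun t => by field_simp; ring
  have hexp : ∀ t : ℝ, Real.exp (lam * ω (Real.exp t)) / Real.exp t ^ k =
      Real.exp (lam * ω (Real.exp t) - k * t) := fun t => by
    rw [Real.exp_sub, ← Real.exp_nat_mul]
  have hl0 : (0 : EReal) < (lam : EReal) := by exact_mod_cast hlam
  apply le_antisymm
  · have hub : ∀ t : ℝ, 0 ≤ t →
        youngFactor ω lam k ≤ ENNReal.ofReal (Real.exp (lam * ω (Real.exp t) - k * t)) := by
      intro t ht
      rw [youngFactor, ← EReal.exp_coe, EReal.exp_le_exp_iff, EReal.neg_le]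
      have h1 : ((k / lam * t - ω (Real.exp t) : ℝ) : EReal) ≤ youngConj ω (k / lam) :=
        le_iSup₂_of_le t ht le_rfl
      have h2 := mul_le_mul_of_nonneg_left h1 hl0.le
      refine le_trans (le_of_eq ?_) h2
      rw [← EReal.coe_mul, ← EReal.coe_neg]
      congr 1
      field_simp
      ring
    -- The choice t = 0 already gives a finite upper bound.
    have hfin : youngFactor ω lam k ≠ ∞ := ne_top_of_le_ne_top ENNReal.ofReal_ne_top (hub 0 le_rfl)
    rw [← ENNReal.ofReal_toReal hfin]
    apply ENNReal.ofReal_le_ofReal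
    apply le_yf
    intro r hr
    have hr0 : 0 < r := by linarith
    have h := hub (Real.log r) (Real.log_nonneg hr)
    rw [← hexp, Real.exp_log hr0] at h
    exact ENNReal.toReal_le_of_le_ofReal (by positivity) h
  · rw [youngFactor, ← ENNReal.exp_log (ENNReal.ofReal _), EReal.exp_le_exp_iff, EReal.le_neg,
      mul_comm, ← EReal.le_div_iff_mul_le hl0 (EReal.coe_ne_top _)]
    apply iSup₂_le
    intro t ht
    rw [EReal.le_div_iff_mul_le hl0 (EReal.coe_ne_top _), EReal.le_neg,
      ← EReal.exp_le_exp_iff, ENNReal.exp_log, ← EReal.coe_mul, ← EReal.coe_neg, EReal.exp_coe]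
    apply ENNReal.ofReal_le_ofReal
    refine (yf_le ω lam k (Real.one_le_exp ht)).trans_eq ?_
    rw [hexp]
    congr 1
    field_simp
    ring

lemma yf_mul_pow_le (ω : ℝ → ℝ) (lam : ℝ) (k : ℕ) {r : ℝ} (hr : 1 ≤ r) :
    yf ω lam k * r ^ k ≤ Real.exp (lam * ω r) := by
  have := yf_le ω lam k hr
  rwa [le_div_iff₀ (by positivity)] at this

lemma pow_mul_yf_le (hω : IsWeight ω) {lam : ℝ} (hlam : 0 < lam) :
    ∃ C : ℝ, 0 < C ∧ ∀ t, 0 ≤ t → ∀ k, t ^ k * yf ω lam k ≤ C * Real.exp (lam * ω t) := by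
  refine ⟨Real.exp (lam * ω 1), Real.exp_pos _, fun t ht k => ?_⟩
  have hω1 := hω.nonneg 1 zero_le_one
  have hωt := hω.nonneg t ht
  have h1 : 1 ≤ Real.exp (lam * ω 1) := Real.one_le_exp (by positivity)
  have h2 : 1 ≤ Real.exp (lam * ω t) := Real.one_le_exp (by positivity)
  rcases le_total 1 t with h | h
  · rw [mul_comm]
    exact (yf_mul_pow_le ω lam k h).trans (le_mul_of_one_le_left (by positivity) h1)
  · have h3 := yf_le ω lam k le_rfl
    simp only [one_pow, div_one] at h3
    calc _ ≤ 1 * Real.exp (lam * ω 1) :=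
          mul_le_mul (pow_le_one₀ ht h) h3 (yf_nonneg _ _ _) zero_le_one
      _ ≤ Real.exp (lam * ω 1) * Real.exp (lam * ω t) := by
          rw [one_mul]; exact le_mul_of_one_le_right (by positivity) h2

lemma yf_mono (hω : IsWeight ω) {lam mu : ℝ} (h : lam ≤ mu) (k : ℕ) : yf ω lam k ≤ yf ω mu k := by
  apply le_yf
  intro r hr
  refine (yf_le ω lam k hr).trans ?_
  have := hω.nonneg r (by linarith)
  gcongr

/-- Test the infimum on the left at max(r, s): the denominator only grows, and the extra exponential
is at least 1. -/
lemma yf_add_le (hω : IsWeight ω) {lam : ℝ} (hlam : 0 < lam) (k l : ℕ) :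
    yf ω lam (k + l) ≤ yf ω lam k * yf ω lam l := by
  have key : ∀ r s : ℝ, 1 ≤ r → 1 ≤ s → yf ω lam (k + l) ≤
      Real.exp (lam * ω r) / r ^ k * (Real.exp (lam * ω s) / s ^ l) := by
    intro r s hr hs
    have hr0 := hω.nonneg r (by linarith)
    have hs0 := hω.nonneg s (by linarith)
    have h1r : 1 ≤ Real.exp (lam * ω r) := Real.one_le_exp (by positivity)
    have h1s : 1 ≤ Real.exp (lam * ω s) := Real.one_le_exp (by positivity)
    rw [div_mul_div_comm]
    rcases le_total r s with h | h
    · refine (yf_le ω lam _ hs).trans ?_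
      rw [pow_add]
      gcongr
      exact le_mul_of_one_le_left (by positivity) h1r
    · refine (yf_le ω lam _ hr).trans ?_
      rw [pow_add]
      gcongr
      exact le_mul_of_one_le_right (by positivity) h1s
  have h2 : ∀ s : ℝ, 1 ≤ s →
      yf ω lam (k + l) ≤ yf ω lam k * (Real.exp (lam * ω s) / s ^ l) := by
    intro s hs
    have hp : 0 < Real.exp (lam * ω s) / s ^ l := by positivity
    rw [← div_le_iff₀ hp]
    apply le_yf
    intro r hr
    rw [div_le_iff₀ hp]
    exact key r s hr hs
  -- The factor vanishes where φ* is infinite, so dividing by it needs a separate case.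
  rcases (yf_nonneg ω lam k).eq_or_lt with h0 | hp
  · have := h2 1 le_rfl
    rw [← h0, zero_mul] at this ⊢
    exact this
  · rw [← div_le_iff₀' hp]
    apply le_yf
    intro s hs
    rw [div_le_iff₀' hp]
    exact h2 s hs

/-- Both infima on the left may be tested at the same r. -/
lemma yf_mul_le (lam mu : ℝ) (k l : ℕ) :
    yf ω lam k * yf ω mu l ≤ yf ω (lam + mu) (k + l) := by
  apply le_yf
  intro r hr
  rw [add_mul, Real.exp_add, pow_add, ← div_mul_div_comm]
  exact mul_le_mul (yf_le ω lam k hr) (yf_le ω mu l hr) (yf_nonneg _ _ _) (by positivity)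

/-- Testing at Ar instead of r produces A^k, and (α) pays for the dilation by a larger parameter. -/
lemma pow_mul_yf_le_yf (hω : IsWeight ω) {A : ℝ} (hA : 1 ≤ A) {lam : ℝ} (hlam : 0 < lam) :
    ∃ mu C : ℝ, 0 < mu ∧ 0 < C ∧ ∀ k, A ^ k * yf ω lam k ≤ C * yf ω mu k := by
  obtain ⟨mu, C, hmu, hC, h⟩ := hω.exp_dilation A (by linarith) hlam
  refine ⟨mu, C, hmu, hC, fun k => ?_⟩
  rw [← div_le_iff₀' hC]
  apply le_yf
  intro r hr
  rw [div_le_iff₀' hC, ← mul_div_assoc, le_div_iff₀ (by positivity)]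
  have h1 := yf_mul_pow_le ω lam k (r := A * r) (by nlinarith)
  rw [mul_pow] at h1
  have h2 := h r (by linarith)
  calc _ = yf ω lam k * (A ^ k * r ^ k) := by ring
    _ ≤ _ := h1.trans h2

lemma yf_zero (hω : IsWeight ω) {lam : ℝ} (hlam : 0 < lam) :
    yf ω lam 0 = Real.exp (lam * ω 1) := by
  apply le_antisymm
  · simpa using yf_le ω lam 0 le_rfl
  · apply le_yf
    intro r hr
    have := hω.mono_le zero_le_one hr
    simp only [pow_zero, div_one]
    gcongr

/-- The quantitative form of φ** = φ: the exponent k is λ times the slope of an affine minorant of φ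
near log t, rounded up to an integer. -/
lemma exp_le_pow_mul_yf (hω : IsWeight ω) {lam : ℝ} (hlam : 0 < lam) :
    ∃ mu C : ℝ, 0 < mu ∧ 0 < C ∧ ∀ t, 0 ≤ t → ∃ k : ℕ,
      Real.exp (lam * ω t) ≤ C * (t ^ k * yf ω mu k) := by
  obtain ⟨a, b, hb, hg⟩ := hω.gamma
  have hmu : 0 < lam + 1 / b := by positivity
  refine ⟨lam + 1 / b, Real.exp (lam + |a| / b), hmu, Real.exp_pos _, fun t ht => ?_⟩
  have hC : 1 ≤ Real.exp (lam + |a| / b) := Real.one_le_exp (by positivity)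
  rcases le_total t 1 with h | h
  · refine ⟨0, ?_⟩
    rw [yf_zero hω hmu, pow_zero, one_mul]
    have h1 := hω.mono_le ht h
    have h2 := hω.nonneg t ht
    calc Real.exp (lam * ω t) ≤ Real.exp ((lam + 1 / b) * ω 1) := by
          gcongr
          linarith [show 0 < 1 / b by positivity]
      _ ≤ _ := le_mul_of_one_le_left (by positivity) hC
  · have ht0 : 0 < t := by linarith
    have hcont : Continuous fun s => ω (Real.exp s) := by
      rw [← continuousOn_univ]
      exact hω.continuousOn.comp Real.continuous_exp.continuousOn fun s _ =>
        Set.mem_Ici.2 (Real.exp_pos s).le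
    -- An affine minorant of φ that lies exactly 1 below φ at log t; this loss costs only the factor
    -- e^λ.
    obtain ⟨l, c, hlc, hx⟩ := ConvexOn.exists_affine_le_of_lt_real
      (s := Set.univ) (f := fun s => ω (Real.exp s)) (x := Real.log t) (a := ω t - 1)
      (Set.mem_univ _) (by simp [Real.exp_log ht0]) isClosed_univ
      (hcont.lowerSemicontinuous.lowerSemicontinuousOn _) hω.delta
    -- With negative slope, moving left by 2/|l| would raise the minorant to ω(t) + 1, above the
    -- value of the increasing φ.
    have hl0 : 0 ≤ l := by
      by_contra! hneg
      have h1 := hlc (Real.log t + 2 / l) (Set.mem_univ _)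
      have h2 : Real.exp (Real.log t + 2 / l) ≤ t := by
        rw [Real.exp_add, Real.exp_log ht0]
        refine mul_le_of_le_one_right ht (Real.exp_le_one_iff.2 ?_)
        exact div_nonpos_of_nonneg_of_nonpos zero_le_two hneg.le
      have h3 := hω.mono_le (Real.exp_pos _).le h2
      have h4 : l * (Real.log t + 2 / l) = l * Real.log t + 2 := by
        have := hneg.ne
        field_simp
      linarith
    -- Rounding up costs at most one factor r, which (γ) absorbs through the extra 1/b in the
    -- parameter: ω(r)/b ≥ a/b + log r.
    set k := ⌈lam * l⌉₊ with hk
    have hk1 : lam * l ≤ k := Nat.le_ceil _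
    have hk2 : (k : ℝ) < lam * l + 1 := Nat.ceil_lt_add_one (by positivity)
    refine ⟨k, ?_⟩
    have hlow : Real.exp (lam * c + a / b) ≤ yf ω (lam + 1 / b) k := by
      apply le_yf
      intro r hr
      have hr0 : 0 < r := by linarith
      have hr1 : 0 ≤ Real.log r := Real.log_nonneg hr
      have e1 : r ^ k = Real.exp (k * Real.log r) := by
        rw [mul_comm, ← Real.rpow_def_of_pos hr0, Real.rpow_natCast]
      rw [e1, ← Real.exp_sub]
      apply Real.exp_le_exp.2
      have e2 := hlc (Real.log r) (Set.mem_univ _)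
      simp only [Real.exp_log hr0] at e2
      have e3 := hg r hr0.le
      have e4 : Real.log r ≤ Real.log (1 + r) := Real.log_le_log hr0 (by linarith)
      have e5 : 1 / b * (a + b * Real.log r) ≤ 1 / b * ω r := by
        gcongr
        nlinarith
      have e6 : 1 / b * (a + b * Real.log r) = a / b + Real.log r := by field_simp
      have e7 := mul_le_mul_of_nonneg_left e2 hlam.le
      have e8 : (k : ℝ) * Real.log r ≤ (lam * l + 1) * Real.log r := by gcongr
      linarith
    have e1 : t ^ k = Real.exp (k * Real.log t) := by
      rw [mul_comm, ← Real.rpow_def_of_pos ht0, Real.rpow_natCast]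
    calc Real.exp (lam * ω t) ≤
        Real.exp (lam + |a| / b) * (Real.exp (k * Real.log t) * Real.exp (lam * c + a / b)) := by
          rw [← Real.exp_add, ← Real.exp_add]
          apply Real.exp_le_exp.2
          have e2 : lam * l * Real.log t ≤ k * Real.log t := by
            gcongr
            exact Real.log_nonneg h
          have e3 : lam * (l * Real.log t + c) = lam * (ω t - 1) := by rw [hx]
          have e4 : 0 ≤ |a| / b + a / b := by
            rw [← add_div]
            exact div_nonneg (by linarith [neg_abs_le a]) hb.le
          linarith
      _ ≤ _ := by
          rw [e1]
          gcongr

/-- For logarithmic ω the factor vanishes when the parameter is small compared with k, so the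
parameter has to depend on k. -/
lemma yf_pos (hω : IsWeight ω) (k : ℕ) :
    ∃ mu : ℝ, 0 < mu ∧ 0 < yf ω mu k := by
  obtain ⟨c, C, hc, hC, h⟩ := hω.pow_le_exp k
  refine ⟨c, hc, lt_of_lt_of_le (by positivity : 0 < 1 / C) (le_yf fun r hr => ?_)⟩
  rw [div_le_div_iff₀ hC (by positivity), one_mul]
  refine le_trans ?_ ((h r (by linarith)).trans_eq (mul_comm _ _))
  gcongr
  linarith

lemma yf_le_yf_add (hω : IsWeight ω) {lam : ℝ} (hlam : 0 < lam) (m : ℕ) :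
    ∃ mu C : ℝ, 0 < mu ∧ 0 < C ∧ ∀ k, yf ω lam k ≤ C * yf ω mu (k + m) := by
  obtain ⟨c, hc, hp⟩ := yf_pos hω m
  refine ⟨lam + c, 1 / yf ω c m, by positivity, by positivity, fun k => ?_⟩
  have := yf_mul_le (ω := ω) lam c k m
  rw [one_div, ← div_eq_inv_mul, le_div_iff₀ hp]
  exact this

/-- `inf_{r ≥ 1} e^{lam ω(r)} (r + k)^{-k}`. -/
def yft (ω : ℝ → ℝ) (lam : ℝ) (k : ℕ) : ℝ :=
  ⨅ r : Set.Ici (1 : ℝ), Real.exp (lam * ω r) / ((r : ℝ) + k) ^ k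

lemma yft_le (ω : ℝ → ℝ) (lam : ℝ) (k : ℕ) {r : ℝ} (hr : 1 ≤ r) :
    yft ω lam k ≤ Real.exp (lam * ω r) / (r + k) ^ k := by
  refine ciInf_le (f := fun r : Set.Ici (1 : ℝ) => Real.exp (lam * ω r) / ((r : ℝ) + k) ^ k)
    ⟨0, ?_⟩ ⟨r, hr⟩
  rintro _ ⟨r, rfl⟩
  have : (1 : ℝ) ≤ r := r.2
  positivity

lemma le_yft {lam : ℝ} {k : ℕ} {c : ℝ}
    (h : ∀ r : ℝ, 1 ≤ r → c ≤ Real.exp (lam * ω r) / (r + k) ^ k) : c ≤ yft ω lam k :=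
  le_ciInf fun r => h r r.2

lemma yft_nonneg (ω : ℝ → ℝ) (lam : ℝ) (k : ℕ) : 0 ≤ yft ω lam k :=
  le_yft fun r hr => by positivity

lemma yft_le_yf (ω : ℝ → ℝ) (lam : ℝ) (k : ℕ) : yft ω lam k ≤ yf ω lam k := by
  apply le_yf
  intro r hr
  refine (yft_le ω lam k hr).trans ?_
  gcongr
  simp

/-- The reason for the shift in `yft`: (r+k+1)^{k+1} ≥ (k+1)(r+k)^k. This recursion absorbs the
integer coefficients of commutators. -/
lemma mul_yft_succ_le (ω : ℝ → ℝ) (lam : ℝ) (k : ℕ) :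
    ((k : ℝ) + 1) * yft ω lam (k + 1) ≤ yft ω lam k := by
  apply le_yft
  intro r hr
  have h := yft_le ω lam (k + 1) hr
  push_cast at h
  have hr0 : 0 < r := by linarith
  rw [le_div_iff₀ (by positivity)] at h ⊢
  refine le_trans ?_ h
  calc (k + 1 : ℝ) * yft ω lam (k + 1) * (r + k) ^ k
      = yft ω lam (k + 1) * ((r + k) ^ k * (k + 1)) := by ring
    _ ≤ yft ω lam (k + 1) * ((r + (k + 1)) ^ k * (r + (k + 1))) := by
        have := yft_nonneg ω lam (k + 1)
        refine mul_le_mul_of_nonneg_left (mul_le_mul ?_ (by linarith) (by positivity)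
          (by positivity)) this
        gcongr
        linarith
    _ = _ := by rw [pow_succ]

lemma yft_succ_le (ω : ℝ → ℝ) (lam : ℝ) (k : ℕ) : yft ω lam (k + 1) ≤ yft ω lam k := by
  refine le_trans ?_ (mul_yft_succ_le ω lam k)
  have := yft_nonneg ω lam (k + 1)
  exact le_mul_of_one_le_left this (by linarith [(Nat.cast_nonneg k : (0 : ℝ) ≤ k)])

lemma yft_antitone (ω : ℝ → ℝ) (lam : ℝ) : Antitone (yft ω lam) :=
  antitone_nat_of_succ_le (yft_succ_le ω lam)

/-- If k ≤ r, then r + k ≤ 2r and only 2^k is lost. Otherwise r + k ≤ 2k, and testing `yf` at k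
itself gives k^k `yf` ≤ e^{λω(k)} ≤ C e^k by ω(t) ≤ t/λ + c. Since e < 3, the constant 6 = 2 · 3
serves both cases. This is where (β) enters. -/
lemma yf_le_pow_mul_yft (hω : IsWeight ω) {lam : ℝ} (hlam : 0 < lam) :
    ∃ C : ℝ, 0 < C ∧ ∀ k : ℕ, yf ω lam k ≤ C * (6 ^ k * yft ω lam k) := by
  obtain ⟨c, hc, h⟩ := hω.le_linear (ε := 1 / lam) (by positivity)
  refine ⟨Real.exp (lam * c), Real.exp_pos _, fun k => ?_⟩
  have hC1 : 1 ≤ Real.exp (lam * c) := Real.one_le_exp (by positivity)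
  rw [← mul_assoc, ← div_le_iff₀' (by positivity)]
  apply le_yft
  intro r hr
  have hr0 : 0 < r := by linarith
  rw [div_le_div_iff₀ (by positivity) (by positivity)]
  have hexp1 : 1 ≤ Real.exp (lam * ω r) :=
    Real.one_le_exp (mul_nonneg hlam.le (hω.nonneg r hr0.le))
  rcases le_total (k : ℝ) r with hk | hk
  · calc yf ω lam k * (r + k) ^ k ≤ yf ω lam k * (2 * r) ^ k := by
          have := yf_nonneg ω lam k
          gcongr; linarith
      _ = 2 ^ k * (yf ω lam k * r ^ k) := by rw [mul_pow]; ring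
      _ ≤ 6 ^ k * Real.exp (lam * ω r) := by
          have := yf_nonneg ω lam k
          gcongr
          · norm_num
          · exact yf_mul_pow_le ω lam k hr
      _ ≤ _ := by
          rw [mul_comm]
          gcongr
          exact le_mul_of_one_le_left (by positivity) hC1
  · have hk1 : (1 : ℝ) ≤ k := hr.trans hk
    have h1 : Real.exp (lam * ω k) ≤ Real.exp (lam * c) * 3 ^ k := by
      calc Real.exp (lam * ω k) ≤ Real.exp (lam * (1 / lam * k + c)) := by
            gcongr; exact h k (by positivity)
        _ = Real.exp (lam * c) * Real.exp 1 ^ k := by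
            rw [← Real.exp_nat_mul, ← Real.exp_add]; congr 1; field_simp
            ring
        _ ≤ _ := by gcongr; exact Real.exp_one_lt_three.le
    calc yf ω lam k * (r + k) ^ k ≤ yf ω lam k * (2 * k) ^ k := by
          have := yf_nonneg ω lam k
          gcongr; linarith
      _ = 2 ^ k * (yf ω lam k * (k : ℝ) ^ k) := by rw [mul_pow]; ring
      _ ≤ 2 ^ k * (Real.exp (lam * c) * 3 ^ k) := by
          refine mul_le_mul_of_nonneg_left ?_ (by positivity)
          exact (yf_mul_pow_le ω lam k hk1).trans h1
      _ = 1 * (Real.exp (lam * c) * 6 ^ k) := by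
          rw [show (6 : ℝ) = 2 * 3 by norm_num, mul_pow]; ring
      _ ≤ _ := by gcongr

end Weight

/-! ### Operators on Schwartz functions -/

section Operators

open MeasureTheory
open scoped LineDeriv FourierTransform

variable {n : ℕ}

/-- The operator `D_j` on Schwartz functions. -/
def Dop (j : Fin n) : 𝓢(E n, ℂ) →L[ℂ] 𝓢(E n, ℂ) :=
  (-Complex.I) • LineDeriv.lineDerivOpCLM ℂ 𝓢(E n, ℂ) (EuclideanSpace.single j (1 : ℝ))

/-- Multiplication by `x_j` on Schwartz functions. -/
def Xop (j : Fin n) : 𝓢(E n, ℂ) →L[ℂ] 𝓢(E n, ℂ) :=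
  SchwartzMap.smulLeftCLM ℂ (fun x : E n => ((x j : ℝ) : ℂ))

lemma Dop_eq (j : Fin n) (f : 𝓢(E n, ℂ)) :
    Dop j f = (-Complex.I) • ∂_{EuclideanSpace.single j (1 : ℝ)} f := rfl

lemma Dop_apply (j : Fin n) (f : 𝓢(E n, ℂ)) (x : E n) :
    Dop j f x = -Complex.I * fderiv ℝ f x (EuclideanSpace.single j 1) := rfl

lemma coe_Dop (j : Fin n) (f : 𝓢(E n, ℂ)) : ⇑(Dop j f) = Dj j ⇑f := by
  ext x
  rw [Dop_apply, Dj, f.differentiableAt.lineDeriv_eq_fderiv]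

lemma temperate_coord (j : Fin n) :
    Function.HasTemperateGrowth (fun x : E n => ((x j : ℝ) : ℂ)) :=
  (Complex.ofRealCLM.comp (EuclideanSpace.proj j : E n →L[ℝ] ℝ)).hasTemperateGrowth

lemma Xop_apply (j : Fin n) (f : 𝓢(E n, ℂ)) (x : E n) : Xop j f x = (x j : ℂ) * f x := by
  rw [Xop, SchwartzMap.smulLeftCLM_apply_apply (temperate_coord j), smul_eq_mul]

lemma Dop_Xop (i j : Fin n) (f : 𝓢(E n, ℂ)) :
    Dop j (Xop i f) = Xop i (Dop j f) + (if i = j then -Complex.I else 0) • f := by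
  ext x
  have h1 : HasFDerivAt (fun y : E n => ((y i : ℝ) : ℂ))
      (Complex.ofRealCLM.comp (EuclideanSpace.proj i : E n →L[ℝ] ℝ)) x :=
    (Complex.ofRealCLM.comp (EuclideanSpace.proj i : E n →L[ℝ] ℝ)).hasFDerivAt
  have h2 : (⇑(Xop i f) : E n → ℂ) = fun y => ((y i : ℝ) : ℂ) * f y := by
    ext y; exact Xop_apply i f y
  have h3 : HasFDerivAt (fun y : E n => ((y i : ℝ) : ℂ) * f y) _ x :=
    h1.mul f.differentiableAt.hasFDerivAt
  rw [Dop_apply, h2, h3.fderiv]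
  simp only [add_apply, smul_apply, Xop_apply, Dop_apply]
  simp [PiLp.single_apply]
  split_ifs <;> push_cast <;> ring

/-- Iterated derivatives along a list of directions. -/
def Dw (a : List (Fin n)) (f : 𝓢(E n, ℂ)) : 𝓢(E n, ℂ) := a.foldr (fun j g => Dop j g) f

/-- Iterated multiplications by the coordinates in a list. -/
def Xw (b : List (Fin n)) (f : 𝓢(E n, ℂ)) : 𝓢(E n, ℂ) := b.foldr (fun j g => Xop j g) f

@[simp] lemma Dw_nil (f : 𝓢(E n, ℂ)) : Dw [] f = f := rfl
@[simp] lemma Dw_cons (j : Fin n) (a : List (Fin n)) (f : 𝓢(E n, ℂ)) :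
    Dw (j :: a) f = Dop j (Dw a f) := rfl
@[simp] lemma Xw_nil (f : 𝓢(E n, ℂ)) : Xw [] f = f := rfl
@[simp] lemma Xw_cons (j : Fin n) (b : List (Fin n)) (f : 𝓢(E n, ℂ)) :
    Xw (j :: b) f = Xop j (Xw b f) := rfl

lemma Xw_append (a a' : List (Fin n)) (f : 𝓢(E n, ℂ)) : Xw (a ++ a') f = Xw a (Xw a' f) :=
  List.foldr_append

lemma Xw_apply (b : List (Fin n)) (f : 𝓢(E n, ℂ)) (x : E n) :
    Xw b f x = (b.map fun j => (x j : ℂ)).prod * f x := by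
  induction b with
  | nil => simp
  | cons j b ih => rw [Xw_cons, Xop_apply, ih, List.map_cons, List.prod_cons, mul_assoc]

lemma Xw_perm {b b' : List (Fin n)} (h : b.Perm b') (f : 𝓢(E n, ℂ)) : Xw b f = Xw b' f := by
  ext x
  rw [Xw_apply, Xw_apply, (h.map _).prod_eq]

/-- The list of directions of a multi-index. -/
def word (α : Fin n → ℕ) : List (Fin n) :=
  (List.finRange n).flatMap fun j => List.replicate (α j) j

lemma length_word (α : Fin n → ℕ) : (word α).length = len α := by
  simp [word, len, List.length_flatMap, ← List.ofFn_eq_map, List.sum_ofFn]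

lemma prod_word (β : Fin n → ℕ) (x : E n) :
    ((word β).map fun j => (x j : ℂ)).prod = (mono β x : ℂ) := by
  have h : ∀ l : List (Fin n),
      ((l.flatMap fun j => List.replicate (β j) j).map fun j => (x j : ℂ)).prod =
        (l.map fun j => (x j : ℂ) ^ β j).prod := by
    intro l
    induction l with
    | nil => rfl
    | cons j l ih => simp [ih]
  rw [word, h, mono, ← List.ofFn_eq_map, List.prod_ofFn]
  push_cast
  rfl

lemma coe_Xw_word (β : Fin n → ℕ) (f : 𝓢(E n, ℂ)) : ⇑(Xw (word β) f) = mulMono β ⇑f := by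
  ext x
  rw [Xw_apply, prod_word, mulMono]

lemma norm_coord_prod_le (b : List (Fin n)) (x : E n) :
    ‖(b.map fun j => (x j : ℂ)).prod‖ ≤ ‖x‖ ^ b.length := by
  induction b with
  | nil => simp
  | cons j b ih =>
    rw [List.map_cons, List.prod_cons, norm_mul, List.length_cons, pow_succ']
    refine mul_le_mul ?_ ih (norm_nonneg _) (norm_nonneg _)
    rw [Complex.norm_real]
    exact PiLp.norm_apply_le x j

/-! ### The Fourier transform in the normalisation of `hat` -/

/-- The dilation by `1 / 2π`. -/
def dil (n : ℕ) : E n ≃L[ℝ] E n :=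
  ContinuousLinearEquiv.smulLeft (Units.mk0 ((2 * Real.pi)⁻¹) (by positivity))

/-- `û` as a Schwartz function. -/
def hatS (f : 𝓢(E n, ℂ)) : 𝓢(E n, ℂ) :=
  SchwartzMap.compCLMOfContinuousLinearEquiv ℂ (dil n) (𝓕 f)

lemma hatS_apply (f : 𝓢(E n, ℂ)) (ξ : E n) : hatS f ξ = 𝓕 f ((2 * Real.pi)⁻¹ • ξ) := rfl

lemma coe_hatS (f : 𝓢(E n, ℂ)) : ⇑(hatS f) = hat ⇑f := by
  ext ξ
  rw [hatS_apply, SchwartzMap.fourier_coe, Real.fourier_eq', hat]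
  congr 1
  ext x
  rw [smul_eq_mul]
  congr 2
  rw [inner_smul_right]
  have : (Real.pi : ℂ) ≠ 0 := by exact_mod_cast Real.pi_ne_zero
  push_cast
  field_simp

lemma norm_hatS_le (f : 𝓢(E n, ℂ)) (ξ : E n) : ‖hatS f ξ‖ ≤ ∫ x, ‖f x‖ := by
  rw [hatS_apply]
  exact (SchwartzMap.norm_fourier_apply_le_toLp_one f _).trans_eq SchwartzMap.norm_toLp_one

lemma hatS_Dop (j : Fin n) (f : 𝓢(E n, ℂ)) (ξ : E n) :
    hatS (Dop j f) ξ = (ξ j : ℂ) * hatS f ξ := by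
  rw [hatS_apply, hatS_apply, Dop_eq, FourierTransform.fourier_smul,
    SchwartzMap.fourier_lineDerivOp_eq]
  have ht : (fun x : E n => inner ℝ x (EuclideanSpace.single j (1 : ℝ))).HasTemperateGrowth :=
    ((innerSL ℝ).flip _).hasTemperateGrowth
  simp only [smul_apply, SchwartzMap.smulLeftCLM_apply_apply ht, smul_eq_mul]
  rw [EuclideanSpace.inner_single_right]
  have : (Real.pi : ℂ) ≠ 0 := by exact_mod_cast Real.pi_ne_zero
  simp
  field_simp
  rw [Complex.I_sq]
  ring

lemma hatS_Dw (a : List (Fin n)) (f : 𝓢(E n, ℂ)) (ξ : E n) :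
    hatS (Dw a f) ξ = (a.map fun j => (ξ j : ℂ)).prod * hatS f ξ := by
  induction a with
  | nil => simp
  | cons j a ih => rw [Dw_cons, hatS_Dop, ih, List.map_cons, List.prod_cons, mul_assoc]

lemma hatS_hatS (f : 𝓢(E n, ℂ)) (x : E n) :
    hatS (hatS f) x = (2 * Real.pi : ℝ) ^ n • f (-x) := by
  have h1 : f (-x) = 𝓕 (𝓕 f) x := by
    have h2 : 𝓕⁻ (𝓕 f) = f := FourierTransform.fourierInv_fourier_eq f
    conv_lhs => rw [← h2]
    rw [SchwartzMap.fourierInv_coe, Real.fourierInv_eq_fourier_neg, neg_neg]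
    rfl
  rw [h1, coe_hatS, hat, SchwartzMap.fourier_coe, Real.fourier_eq']
  have h3 := Measure.integral_comp_smul (volume : Measure (E n))
    (fun y => Complex.exp (((-2 * Real.pi * inner ℝ y x : ℝ) : ℂ) * Complex.I) • 𝓕 f y)
    ((2 * Real.pi)⁻¹)
  rw [finrank_euclideanSpace_fin, inv_pow, inv_inv, abs_of_pos (by positivity)] at h3
  rw [← h3]
  congr 1
  ext y
  rw [hatS_apply, smul_eq_mul]
  congr 2
  rw [inner_smul_left]
  have : (Real.pi : ℂ) ≠ 0 := by exact_mod_cast Real.pi_ne_zero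
  simp
  field_simp

lemma norm_le_integral_hatS (f : 𝓢(E n, ℂ)) (x : E n) : ‖f x‖ ≤ ∫ ξ, ‖hatS f ξ‖ := by
  have h := norm_hatS_le (hatS f) (-x)
  rw [hatS_hatS, neg_neg, norm_smul] at h
  -- The inversion constant (2π)^n is at least 1 and is dropped.
  refine le_trans (le_mul_of_one_le_left (norm_nonneg _) ?_) h
  rw [norm_pow, Real.norm_of_nonneg (by positivity)]
  exact one_le_pow₀ (by linarith [Real.pi_gt_three])

lemma integral_hatS_sq (f : 𝓢(E n, ℂ)) :
    ∫ ξ, ‖hatS f ξ‖ ^ 2 = (2 * Real.pi : ℝ) ^ n * ∫ x, ‖f x‖ ^ 2 := by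
  have h3 := Measure.integral_comp_smul (volume : Measure (E n))
    (fun y => ‖𝓕 f y‖ ^ 2) ((2 * Real.pi)⁻¹)
  rw [finrank_euclideanSpace_fin, inv_pow, inv_inv, abs_of_pos (by positivity)] at h3
  rw [← SchwartzMap.integral_norm_sq_fourier f, ← smul_eq_mul, ← h3]
  rfl

end Operators

/-! ### Estimates with exponential weights -/

section Estimates

open MeasureTheory

variable {n : ℕ} {ω : ℝ → ℝ}

/-- `e^{lam ω(x)} |f(x)| ≤ A` for all `x`. -/
def ExpBound (ω : ℝ → ℝ) (lam : ℝ) (f : E n → ℂ) (A : ℝ) : Prop :=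
  ∀ x, Real.exp (lam * ω ‖x‖) * ‖f x‖ ≤ A

lemma ExpBound.nonneg {lam A : ℝ} {f : E n → ℂ} (h : ExpBound ω lam f A) : 0 ≤ A :=
  le_trans (by positivity) (h 0)

lemma ExpBound.anti (hω : IsWeight ω) {lam mu A : ℝ} {f : E n → ℂ} (h : ExpBound ω mu f A)
    (hle : lam ≤ mu) : ExpBound ω lam f A := fun x => by
  refine le_trans ?_ (h x)
  have := hω.nonneg ‖x‖ (norm_nonneg x)
  gcongr

lemma integral_norm_le_of_decay (n : ℕ) : ∃ I : ℝ, 0 < I ∧ ∀ (f : 𝓢(E n, ℂ)) (A : ℝ),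
    (∀ x, (1 + ‖x‖) ^ (n + 1) * ‖f x‖ ≤ A) → ∫ x, ‖f x‖ ≤ I * A := by
  have hint : Integrable (fun x : E n => (1 + ‖x‖) ^ (-((n + 1 : ℕ) : ℝ))) :=
    integrable_one_add_norm (by rw [finrank_euclideanSpace_fin]; simp)
  refine ⟨(∫ x : E n, (1 + ‖x‖) ^ (-((n + 1 : ℕ) : ℝ))) + 1, ?_, fun f A h => ?_⟩
  · have : 0 ≤ ∫ x : E n, (1 + ‖x‖) ^ (-((n + 1 : ℕ) : ℝ)) :=
      integral_nonneg fun x => by positivity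
    linarith
  · have hA : 0 ≤ A := le_trans (by positivity) (h 0)
    calc ∫ x, ‖f x‖ ≤ ∫ x : E n, (1 + ‖x‖) ^ (-((n + 1 : ℕ) : ℝ)) * A := by
          apply integral_mono f.integrable.norm (hint.mul_const A)
          intro x
          have hx := h x
          have h0 : 0 < (1 + ‖x‖) := by positivity
          simp only [Real.rpow_neg h0.le, Real.rpow_natCast]
          rw [← div_eq_inv_mul, le_div_iff₀' (by positivity)]
          exact hx
      _ = (∫ x : E n, (1 + ‖x‖) ^ (-((n + 1 : ℕ) : ℝ))) * A := integral_mul_const _ _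
      _ ≤ _ := by gcongr; simp

/-- The exponent λ + c splits: e^{λω} pays for the monomial through `yf`, and e^{cω} dominates
(1+|x|)^{n+1}, which gives integrability. -/
lemma integral_Xw_mul_yf_le (hω : IsWeight ω) (n : ℕ) {lam : ℝ} (hlam : 0 < lam) :
    ∃ mu C : ℝ, 0 < mu ∧ 0 < C ∧ ∀ (f : 𝓢(E n, ℂ)) (A : ℝ), ExpBound ω mu f A →
      ∀ b : List (Fin n), (∫ x, ‖Xw b f x‖) * yf ω lam b.length ≤ C * A := by
  obtain ⟨I, hI, hint⟩ := integral_norm_le_of_decay n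
  obtain ⟨c, C, hc, hC, hpow⟩ := hω.pow_le_exp (n + 1)
  obtain ⟨K, hK, hyf⟩ := pow_mul_yf_le hω hlam
  refine ⟨lam + c, I * (C * K), by positivity, by positivity, fun f A h b => ?_⟩
  have hy := yf_nonneg ω lam b.length
  have key := hint ((yf ω lam b.length : ℂ) • Xw b f) (C * K * A) fun x => by
    rw [smul_apply, norm_smul, Xw_apply, norm_mul, Complex.norm_real,
      Real.norm_of_nonneg hy]
    have h1 := hpow ‖x‖ (norm_nonneg x)
    have h2 := hyf ‖x‖ (norm_nonneg x) b.length
    have h3 := norm_coord_prod_le b x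
    calc (1 + ‖x‖) ^ (n + 1) * (yf ω lam b.length *
          (‖(b.map fun j => (x j : ℂ)).prod‖ * ‖f x‖))
        ≤ (C * Real.exp (c * ω ‖x‖)) * (yf ω lam b.length * (‖x‖ ^ b.length * ‖f x‖)) := by
          gcongr
      _ = (C * Real.exp (c * ω ‖x‖)) * ((‖x‖ ^ b.length * yf ω lam b.length) * ‖f x‖) := by ring
      _ ≤ (C * Real.exp (c * ω ‖x‖)) * ((K * Real.exp (lam * ω ‖x‖)) * ‖f x‖) := by gcongr
      _ = C * K * (Real.exp ((lam + c) * ω ‖x‖) * ‖f x‖) := by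
          rw [add_mul, Real.exp_add]; ring
      _ ≤ C * K * A := by gcongr; exact h x
  simp only [smul_apply, norm_smul, Complex.norm_real, Real.norm_of_nonneg hy] at key
  rw [integral_const_mul] at key
  linarith

/-- D^a becomes ξ^a under the Fourier transform, and the sup norm is at most the L¹ norm of the
transform. -/
lemma norm_Dw_mul_yf_le (hω : IsWeight ω) (n : ℕ) {lam : ℝ} (hlam : 0 < lam) :
    ∃ mu C : ℝ, 0 < mu ∧ 0 < C ∧ ∀ (f : 𝓢(E n, ℂ)) (A : ℝ), ExpBound ω mu (hatS f) A →
      ∀ (a : List (Fin n)) (x : E n), ‖Dw a f x‖ * yf ω lam a.length ≤ C * A := by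
  obtain ⟨mu, C, hmu, hC, h⟩ := integral_Xw_mul_yf_le hω n hlam
  refine ⟨mu, C, hmu, hC, fun f A hf a x => le_trans ?_ (h (hatS f) A hf a)⟩
  gcongr
  · exact yf_nonneg _ _ _
  · refine (norm_le_integral_hatS _ x).trans_eq ?_
    congr 1
    ext ξ
    rw [hatS_Dw, Xw_apply]

lemma norm_Dw_le (hω : IsWeight ω) (a : List (Fin n)) :
    ∃ mu C : ℝ, 0 < mu ∧ 0 < C ∧ ∀ (f : 𝓢(E n, ℂ)) (A : ℝ), ExpBound ω mu (hatS f) A →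
      ∀ x : E n, ‖Dw a f x‖ ≤ C * A := by
  obtain ⟨lam, hlam, hp⟩ := yf_pos hω a.length
  obtain ⟨mu, C, hmu, hC, h⟩ := norm_Dw_mul_yf_le hω n hlam
  refine ⟨mu, C / yf ω lam a.length, hmu, by positivity, fun f A hf x => ?_⟩
  have := h f A hf a x
  rw [div_mul_eq_mul_div, le_div_iff₀ hp]
  exact this

/-- A Landau-type inequality along a coordinate line. Two uses of the mean value inequality replace
the Taylor formula, so the remainder carries h² M rather than h² M/2. -/
lemma norm_taylor_le (g : 𝓢(E n, ℂ)) (j : Fin n) {M : ℝ}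
    (hM : ∀ x, ‖Dop j (Dop j g) x‖ ≤ M) (x : E n) {h : ℝ} (hh : 0 ≤ h) :
    h * ‖Dop j g x‖ ≤
      ‖g (x + h • EuclideanSpace.single j 1)‖ + ‖g x‖ + h ^ 2 * M := by
  set e : E n := EuclideanSpace.single j 1
  have hline : ∀ (f : 𝓢(E n, ℂ)) (t : ℝ),
      HasDerivAt (fun s : ℝ => f (x + s • e)) (fderiv ℝ f (x + t • e) e) t := by
    intro f t
    have h1 : HasDerivAt (fun s : ℝ => x + s • e) e t := by
      simpa using ((hasDerivAt_id t).smul_const e).const_add x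
    exact (f.differentiableAt.hasFDerivAt).comp_hasDerivAt t h1
  have hnorm : ∀ (f : 𝓢(E n, ℂ)) (y : E n), ‖fderiv ℝ f y e‖ = ‖Dop j f y‖ := by
    intro f y
    rw [Dop_apply, norm_mul]
    simp [e]
  have hfd : ∀ y, fderiv ℝ g y e = Complex.I * Dop j g y := by
    intro y
    rw [Dop_apply, ← mul_assoc]
    simp [e]
  have step1 : ∀ t ∈ Set.Icc 0 h, ‖Dop j g (x + t • e) - Dop j g x‖ ≤ M * h := by
    intro t ht
    have := norm_image_sub_le_of_norm_deriv_le_segment' (f := fun s : ℝ => Dop j g (x + s • e))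
      (f' := fun s => fderiv ℝ (Dop j g) (x + s • e) e) (a := 0) (b := h) (C := M)
      (fun s _ => (hline _ s).hasDerivWithinAt) (fun s _ => by rw [hnorm]; exact hM _) t ht
    simp only [zero_smul, add_zero, sub_zero] at this
    refine this.trans ?_
    have hM0 : 0 ≤ M := (norm_nonneg _).trans (hM 0)
    gcongr
    exact ht.2
  have step2 := norm_image_sub_le_of_norm_deriv_le_segment'
    (f := fun s : ℝ => g (x + s • e) - s • (Complex.I * Dop j g x))
    (f' := fun s => fderiv ℝ g (x + s • e) e - (1 : ℝ) • (Complex.I * Dop j g x))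
    (a := 0) (b := h) (C := M * h)
    (fun s _ => ((hline g s).sub ((hasDerivAt_id s).smul_const _)).hasDerivWithinAt)
    (fun s hs => by
      rw [hfd, one_smul, ← mul_sub, norm_mul, Complex.norm_I, one_mul]
      exact step1 s ⟨hs.1, hs.2.le⟩) h ⟨hh, le_rfl⟩
  simp only [zero_smul, add_zero, sub_zero] at step2
  have h3 : h * ‖Dop j g x‖ = ‖h • (Complex.I * Dop j g x)‖ := by
    rw [norm_smul, norm_mul, Complex.norm_I, one_mul, Real.norm_of_nonneg hh]
  rw [h3]
  have h4 : h • (Complex.I * Dop j g x) = g (x + h • e) - g x -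
      (g (x + h • e) - h • (Complex.I * Dop j g x) - g x) := by ring
  rw [h4]
  refine (norm_sub_le _ _).trans ?_
  have := norm_sub_le (g (x + h • e)) (g x)
  nlinarith

/-- Take the step h = e^{-λω(x)} in the Landau-type inequality and multiply by e^{2λω(x)}. The
remainder becomes M; the values of g are taken within distance 1 of x and are controlled by doubling
the exponent and shifting. -/
lemma expBound_Dop (hω : IsWeight ω) {lam : ℝ} (hlam : 0 < lam) :
    ∃ mu C : ℝ, 0 < mu ∧ 0 < C ∧ ∀ (g : 𝓢(E n, ℂ)) (j : Fin n) (A M : ℝ), ExpBound ω mu g A →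
      (∀ x, ‖Dop j (Dop j g) x‖ ≤ M) → ExpBound ω lam (Dop j g) (C * A + M) := by
  obtain ⟨mu, C, hmu, hC, h⟩ := hω.exp_shift (lam := 2 * lam) (by positivity)
  refine ⟨mu, 2 * C, hmu, by positivity, fun g j A M hg hM x => ?_⟩
  have hω0 := hω.nonneg ‖x‖ (norm_nonneg x)
  set t := Real.exp (lam * ω ‖x‖) with ht
  have ht0 : 0 < t := Real.exp_pos _
  have ht1 : 1 ≤ t := Real.one_le_exp (by positivity)
  have hM0 : 0 ≤ M := (norm_nonneg _).trans (hM 0)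
  have hnear : ∀ y : E n, ‖x‖ ≤ ‖y‖ + 1 → t ^ 2 * ‖g y‖ ≤ C * A := by
    intro y hy
    have h1 : t ^ 2 ≤ C * Real.exp (mu * ω ‖y‖) := by
      rw [ht, ← Real.exp_nat_mul]
      refine le_trans ?_ (h ‖y‖ (norm_nonneg y))
      apply Real.exp_le_exp.2
      have := hω.mono_le (norm_nonneg x) hy
      push_cast
      nlinarith
    calc t ^ 2 * ‖g y‖ ≤ C * Real.exp (mu * ω ‖y‖) * ‖g y‖ := by gcongr
      _ = C * (Real.exp (mu * ω ‖y‖) * ‖g y‖) := by ring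
      _ ≤ C * A := by gcongr; exact hg y
  have h1 := norm_taylor_le g j hM x (h := t⁻¹) (by positivity)
  have h2 := hnear x (by linarith)
  have h3 := hnear (x + t⁻¹ • EuclideanSpace.single j 1) (by
    have e1 : ‖(t⁻¹ • EuclideanSpace.single j 1 : E n)‖ ≤ 1 := by
      rw [norm_smul, PiLp.norm_single, norm_one, mul_one,
        Real.norm_of_nonneg (by positivity)]
      exact inv_le_one_of_one_le₀ ht1
    have e2 := norm_sub_le (x + t⁻¹ • EuclideanSpace.single j 1) (t⁻¹ • EuclideanSpace.single j 1)
    rw [add_sub_cancel_right] at e2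
    linarith)
  have h4 := mul_le_mul_of_nonneg_left h1 (by positivity : 0 ≤ t ^ 2)
  have e1 : t ^ 2 * (t⁻¹ * ‖Dop j g x‖) = t * ‖Dop j g x‖ := by field_simp
  have e2 : t ^ 2 * (t⁻¹ ^ 2 * M) = M := by field_simp
  rw [e1, mul_add, mul_add, e2] at h4
  linarith

lemma expBound_Dw (hω : IsWeight ω) (a : List (Fin n)) : ∀ lam : ℝ, 0 < lam →
    ∃ mu C : ℝ, 0 < mu ∧ 0 < C ∧ ∀ (f : 𝓢(E n, ℂ)) (A B : ℝ), ExpBound ω mu f A →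
      ExpBound ω mu (hatS f) B → ExpBound ω lam (Dw a f) (C * (A + B)) := by
  induction a with
  | nil =>
    intro lam hlam
    refine ⟨lam, 1, hlam, one_pos, fun f A B hA hB x => ?_⟩
    have := hA x
    have := hB.nonneg
    simp only [Dw_nil]
    linarith
  | cons j a ih =>
    intro lam hlam
    obtain ⟨mu₁, C₁, hmu₁, hC₁, h₁⟩ := expBound_Dop (n := n) hω hlam
    obtain ⟨mu₂, C₂, hmu₂, hC₂, h₂⟩ := ih mu₁ hmu₁
    -- The second derivative needed by the interpolation is bounded through û, without any decay in
    -- x.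
    obtain ⟨mu₃, C₃, hmu₃, hC₃, h₃⟩ := norm_Dw_le hω (j :: j :: a)
    refine ⟨max mu₂ mu₃, C₁ * C₂ + C₃, lt_max_of_lt_left hmu₂, by positivity,
      fun f A B hA hB x => ?_⟩
    have h := h₁ (Dw a f) j _ _ (h₂ f A B (hA.anti hω (le_max_left _ _))
      (hB.anti hω (le_max_left _ _))) (h₃ f B (hB.anti hω (le_max_right _ _))) x
    refine h.trans ?_
    have := hA.nonneg
    nlinarith

end Estimates

/-! ### Mixed estimates -/

section Mixed

open MeasureTheory
open scoped LineDeriv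

variable {n : ℕ} {ω : ℝ → ℝ}

/-- The `L²` inner product, linear in the first argument. -/
def ip (f g : 𝓢(E n, ℂ)) : ℂ :=
  inner ℂ (SchwartzMap.toLpCLM ℂ ℂ 2 volume g) (SchwartzMap.toLpCLM ℂ ℂ 2 volume f)

lemma ip_eq (f g : 𝓢(E n, ℂ)) : ip f g = ∫ x, f x * (starRingEnd ℂ) (g x) := by
  rw [ip]
  exact (SchwartzMap.inner_toL2_toL2_eq g f volume)

lemma ip_add_smul (f g h : 𝓢(E n, ℂ)) (c : ℂ) : ip (f + c • g) h = ip f h + c * ip g h := by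
  simp only [ip, map_add, map_smul, inner_add_right, inner_smul_right]

lemma ip_Xop (j : Fin n) (f g : 𝓢(E n, ℂ)) : ip (Xop j f) g = ip f (Xop j g) := by
  rw [ip_eq, ip_eq]
  congr 1
  ext x
  rw [Xop_apply, Xop_apply, map_mul, Complex.conj_ofReal]
  ring

lemma ip_Dop (j : Fin n) (f g : 𝓢(E n, ℂ)) : ip (Dop j f) g = ip f (Dop j g) := by
  have h := SchwartzMap.integral_bilinear_lineDerivOp_right_eq_neg_left (μ := volume) f g
    ((ContinuousLinearMap.mul ℝ ℂ).flip.comp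
      (Complex.conjCLE : ℂ →L[ℝ] ℂ)).flip (EuclideanSpace.single j (1 : ℝ))
  simp only [ContinuousLinearMap.flip_apply, ContinuousLinearMap.comp_apply,
    ContinuousLinearMap.mul_apply'] at h
  rw [ip_eq, ip_eq]
  simp only [Dop_eq, smul_apply, smul_eq_mul, map_mul, map_neg, Complex.conj_I, neg_neg]
  have e1 : ∀ a b c : ℂ, -a * b * c = -a * (b * c) := fun a b c => by ring
  have e2 : ∀ a b c : ℂ, b * (a * c) = a * (b * c) := fun a b c => by ring
  simp only [e1]
  simp only [e2 Complex.I]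
  rw [integral_const_mul, integral_const_mul]
  have h' : ∫ x, f x * (starRingEnd ℂ) ((∂_{EuclideanSpace.single j (1 : ℝ)} g) x) =
      -∫ x, (∂_{EuclideanSpace.single j (1 : ℝ)} f) x * (starRingEnd ℂ) (g x) := h
  rw [h']
  ring

lemma norm_ip_le (f g : 𝓢(E n, ℂ)) {M : ℝ} (hM : ∀ x, ‖g x‖ ≤ M) :
    ‖ip f g‖ ≤ (∫ x, ‖f x‖) * M := by
  rw [ip_eq, ← integral_mul_const]
  refine norm_integral_le_of_norm_le (f.integrable.norm.mul_const M) (ae_of_all _ fun x => ?_)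
  rw [norm_mul, RCLike.norm_conj]
  gcongr
  exact hM x

lemma norm_ip_self (f : 𝓢(E n, ℂ)) : ‖ip f f‖ = ∫ x, ‖f x‖ ^ 2 := by
  rw [ip_eq]
  have h : ∀ x, f x * (starRingEnd ℂ) (f x) = ((‖f x‖ ^ 2 : ℝ) : ℂ) := fun x => by
    rw [Complex.mul_conj, Complex.normSq_eq_norm_sq]
  simp only [h]
  rw [integral_complex_ofReal, Complex.norm_real,
    Real.norm_of_nonneg (integral_nonneg fun x => by positivity)]

/-- The Leibniz rule: the commutator removes one letter j, with coefficient the number of its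
occurrences. -/
lemma Dop_Xw (j : Fin n) (b : List (Fin n)) (g : 𝓢(E n, ℂ)) :
    Dop j (Xw b g) = Xw b (Dop j g) + (-Complex.I * (b.count j : ℕ)) • Xw (b.erase j) g := by
  induction b with
  | nil => simp
  | cons i b ih =>
    rw [Xw_cons, Dop_Xop, ih, Xw_cons, map_add, map_smul]
    by_cases hij : i = j
    · subst hij
      rw [if_pos rfl, List.count_cons_self, List.erase_cons_head]
      by_cases hb : i ∈ b
      · have h : Xop i (Xw (b.erase i) g) = Xw b g := Xw_perm (List.perm_cons_erase hb).symm g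
        rw [h, add_assoc, ← add_smul]
        congr 2
        push_cast
        ring
      · rw [List.count_eq_zero_of_not_mem hb]
        simp
    · rw [if_neg hij, List.count_cons_of_ne (by simpa using hij),
        List.erase_cons_tail (by simpa using hij), Xw_cons]
      simp

/-- The action of a word in the letters `X_j` (left) and `D_j` (right). -/
def act (w : List (Fin n ⊕ Fin n)) (f : 𝓢(E n, ℂ)) : 𝓢(E n, ℂ) :=
  w.foldr (fun l g => Sum.elim (fun j => Xop j g) (fun j => Dop j g) l) f

/-- The number of letters `X_j`. -/
def nX (w : List (Fin n ⊕ Fin n)) : ℕ := w.countP Sum.isLeft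

/-- The number of letters `D_j`. -/
def nD (w : List (Fin n ⊕ Fin n)) : ℕ := w.countP Sum.isRight

lemma act_append (w w' : List (Fin n ⊕ Fin n)) (f : 𝓢(E n, ℂ)) :
    act (w ++ w') f = act w (act w' f) := List.foldr_append

lemma act_map_inl (b : List (Fin n)) (f : 𝓢(E n, ℂ)) : act (b.map Sum.inl) f = Xw b f := by
  induction b with
  | nil => rfl
  | cons j b ih => rw [Xw_cons, ← ih]; rfl

lemma act_map_inr (a : List (Fin n)) (f : 𝓢(E n, ℂ)) : act (a.map Sum.inr) f = Dw a f := by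
  induction a with
  | nil => rfl
  | cons j a ih => rw [Dw_cons, ← ih]; rfl

lemma ip_act (w : List (Fin n ⊕ Fin n)) (f g : 𝓢(E n, ℂ)) :
    ip f (act w g) = ip (act w.reverse f) g := by
  induction w generalizing f with
  | nil => rfl
  | cons l w ih =>
    rw [List.reverse_cons, act_append, ← ih]
    cases l with
    | inl j => exact (ip_Xop j f (act w g)).symm
    | inr j => exact (ip_Dop j f (act w g)).symm

/-- Induction on the word. A letter X joins the block b. A letter D is commuted past b and moved
onto a; the commutator shortens b by one letter, and its coefficient, at most `b.length`, is paid by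
the recursion for `F`. Two terms per letter D give the power of 2. -/
lemma norm_ip_word_le (u : 𝓢(E n, ℂ)) {F : ℕ → ℝ} (hF0 : ∀ k, 0 ≤ F k)
    (hF : ∀ k : ℕ, ((k : ℝ) + 1) * F (k + 1) ≤ F k) {K : ℝ}
    (base : ∀ b a : List (Fin n),
      ‖ip (Xw b u) (Dw a u)‖ * (F b.length * F a.length) ≤ K)
    (w : List (Fin n ⊕ Fin n)) : ∀ b a : List (Fin n),
      ‖ip (Xw b (act w u)) (Dw a u)‖ * (F (b.length + nX w) * F (a.length + nD w)) ≤
        2 ^ nD w * K := by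
  induction w with
  | nil =>
    intro b a
    simpa [nX, nD, act] using base b a
  | cons l w ih =>
    intro b a
    cases l with
    | inl j =>
      have h := ih (b ++ [j]) a
      have e1 : nX (Sum.inl j :: w) = nX w + 1 := List.countP_cons_of_pos rfl
      have e2 : nD (Sum.inl j :: w) = nD w := by simp [nD]
      rw [Xw_append] at h
      rw [e1, e2]
      rw [List.length_append, List.length_singleton, add_assoc, add_comm 1] at h
      exact h
    | inr j =>
      have e1 : nX (Sum.inr j :: w) = nX w := by simp [nX]
      have e2 : nD (Sum.inr j :: w) = nD w + 1 := List.countP_cons_of_pos rfl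
      have e3 : act (Sum.inr j :: w) u = Dop j (act w u) := rfl
      rw [e1, e2, e3]
      set g := act w u with hg
      have e4 : Xw b (Dop j g) =
          Dop j (Xw b g) + (Complex.I * (b.count j : ℕ)) • Xw (b.erase j) g := by
        rw [Dop_Xw, add_assoc, ← add_smul]
        simp
      rw [e4, ip_add_smul, ip_Dop, ← Dw_cons]
      have h1 := ih b (j :: a)
      rw [List.length_cons, add_assoc, add_comm 1] at h1
      have h2 : (b.count j : ℝ) * ‖ip (Xw (b.erase j) g) (Dw a u)‖ *
          (F (b.length + nX w) * F (a.length + (nD w + 1))) ≤ 2 ^ nD w * K := by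
        have hK : 0 ≤ 2 ^ nD w * K :=
          le_trans (mul_nonneg (norm_nonneg _) (mul_nonneg (hF0 _) (hF0 _))) h1
        by_cases hb : j ∈ b
        · refine le_trans ?_ (ih (b.erase j) a)
          have hlen : b.length = (b.erase j).length + 1 := by
            rw [List.length_erase_of_mem hb]
            have := List.length_pos_of_mem hb
            omega
          have hc : (b.count j : ℝ) ≤ ((b.erase j).length + nX w : ℕ) + 1 := by
            have : b.count j ≤ (b.erase j).length + 1 := hlen ▸ List.count_le_length
            have h3 : b.count j ≤ ((b.erase j).length + nX w) + 1 := by omega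
            exact_mod_cast h3
          have h3 := hF ((b.erase j).length + nX w)
          have h4 : F (a.length + nD w + 1) ≤ F (a.length + nD w) := by
            refine le_trans (le_mul_of_one_le_left (hF0 _) ?_) (hF _)
            simp only [le_add_iff_nonneg_left]
            positivity
          have h5 : b.length + nX w = (b.erase j).length + nX w + 1 := by omega
          rw [h5, ← add_assoc]
          calc _ = ‖ip (Xw (b.erase j) g) (Dw a u)‖ * ((b.count j *
                F ((b.erase j).length + nX w + 1)) * F (a.length + nD w + 1)) := by ring
            _ ≤ _ := by
              refine mul_le_mul_of_nonneg_left (mul_le_mul ?_ h4 (hF0 _) (hF0 _)) (norm_nonneg _)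
              exact le_trans (mul_le_mul_of_nonneg_right hc (hF0 _)) h3
        · rw [List.count_eq_zero_of_not_mem hb]
          simpa using hK
      have h3 := norm_add_le (ip (Xw b g) (Dw (j :: a) u))
        (Complex.I * (b.count j : ℕ) * ip (Xw (b.erase j) g) (Dw a u))
      rw [norm_mul (Complex.I * _), norm_mul, Complex.norm_I, one_mul, Complex.norm_natCast] at h3
      calc _ ≤ (‖ip (Xw b g) (Dw (j :: a) u)‖ +
            b.count j * ‖ip (Xw (b.erase j) g) (Dw a u)‖) *
              (F (b.length + nX w) * F (a.length + (nD w + 1))) :=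
            mul_le_mul_of_nonneg_right h3 (mul_nonneg (hF0 _) (hF0 _))
        _ ≤ 2 ^ nD w * K + 2 ^ nD w * K := by rw [add_mul]; exact add_le_add h1 h2
        _ = _ := by ring

/-! ### A Sobolev inequality with pure derivatives -/

lemma norm_le_card_mul {x : E n} {M : ℝ} (hM : ∀ j, |x j| ≤ M) (hM0 : 0 ≤ M) : ‖x‖ ≤ n * M := by
  rw [EuclideanSpace.norm_eq]
  apply Real.sqrt_le_iff.2 ⟨by positivity, ?_⟩
  calc ∑ j, ‖x j‖ ^ 2 ≤ ∑ _j : Fin n, M ^ 2 := by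
        gcongr with j
        exact hM j
    _ = n * M ^ 2 := by simp
    _ ≤ (n : ℝ) ^ 2 * M ^ 2 := by
        gcongr
        exact_mod_cast Nat.le_self_pow two_ne_zero n
    _ = _ := by ring

lemma one_add_norm_pow_le (n N : ℕ) : ∃ C : ℝ, 0 < C ∧ ∀ x : E n,
    (1 + ‖x‖) ^ N ≤ C * (1 + ∑ j, |x j| ^ N) := by
  refine ⟨((n : ℝ) + 1) ^ N, by positivity, fun x => ?_⟩
  obtain ⟨M, hM1, hM, hMN⟩ : ∃ M : ℝ, 1 ≤ M ∧ (∀ j, |x j| ≤ M) ∧ M ^ N ≤ 1 + ∑ j, |x j| ^ N := by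
    by_cases h : ∀ j, |x j| ≤ 1
    · refine ⟨1, le_rfl, h, ?_⟩
      rw [one_pow, le_add_iff_nonneg_right]
      positivity
    · push Not at h
      obtain ⟨i, hi⟩ := h
      have : Nonempty (Fin n) := ⟨i⟩
      obtain ⟨i₀, h₀⟩ := Finite.exists_max fun j => |x j|
      refine ⟨|x i₀|, hi.le.trans (h₀ i), h₀, ?_⟩
      have := Finset.single_le_sum (f := fun j => |x j| ^ N) (fun j _ => by positivity)
        (Finset.mem_univ i₀)
      simp only at this
      linarith
  have h1 : ‖x‖ ≤ n * M := norm_le_card_mul hM (by linarith)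
  calc (1 + ‖x‖) ^ N ≤ (((n : ℝ) + 1) * M) ^ N := by gcongr; linarith
    _ = ((n : ℝ) + 1) ^ N * M ^ N := mul_pow _ _ _
    _ ≤ _ := by gcongr

/-- `f` for `none`, and `D_j^N f` for `some j`. -/
def pureDeriv (N : ℕ) (i : Option (Fin n)) (f : 𝓢(E n, ℂ)) : 𝓢(E n, ℂ) :=
  Dw (i.elim [] fun j => List.replicate N j) f

lemma integrable_norm_sq (f : 𝓢(E n, ℂ)) : Integrable fun x => ‖f x‖ ^ 2 :=
  (memLp_two_iff_integrable_sq_norm f.continuous.aestronglyMeasurable).1 (f.memLp 2)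

/-- Bound |f| by the L¹ norm of its transform, apply Cauchy–Schwarz with the weight (1+|ξ|)^{n+1},
and use Plancherel. Comparing that weight with the |ξ_j|^{n+1} leaves only pure derivatives. -/
lemma norm_sq_le_sum (n : ℕ) : ∃ C : ℝ, 0 < C ∧ ∀ (f : 𝓢(E n, ℂ)) (x : E n),
    ‖f x‖ ^ 2 ≤ C * ∑ i, ∫ y, ‖pureDeriv (n + 1) i f y‖ ^ 2 := by
  obtain ⟨C, hC, hpow⟩ := one_add_norm_pow_le n (n + 1)
  have hint : Integrable (fun x : E n => (1 + ‖x‖) ^ (-((n + 1 : ℕ) : ℝ))) :=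
    integrable_one_add_norm (by rw [finrank_euclideanSpace_fin]; simp)
  set I := ∫ x : E n, (1 + ‖x‖) ^ (-((n + 1 : ℕ) : ℝ)) with hI
  have hI0 : 0 ≤ I := integral_nonneg fun x => by positivity
  refine ⟨(I + 1) * (C * (n + 1) * (2 * Real.pi) ^ n), by positivity, fun f x => ?_⟩
  set Q := ∑ i, ∫ y, ‖pureDeriv (n + 1) i f y‖ ^ 2 with hQ
  have hQ0 : 0 ≤ Q := Finset.sum_nonneg fun i _ => integral_nonneg fun y => by positivity
  set S := ∫ ξ, ‖hatS f ξ‖ with hS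
  have hfS : ‖f x‖ ≤ S := norm_le_integral_hatS f x
  have hS0 : 0 ≤ S := (norm_nonneg _).trans hfS
  have hQ' : ∑ i, ∫ ξ, ‖hatS (pureDeriv (n + 1) i f) ξ‖ ^ 2 = (2 * Real.pi) ^ n * Q := by
    simp only [integral_hatS_sq, ← Finset.mul_sum, hQ]
  have hpt : ∀ ξ, (1 + ‖ξ‖) ^ (n + 1) * ‖hatS f ξ‖ ^ 2 ≤
      C * (n + 1) * ∑ i, ‖hatS (pureDeriv (n + 1) i f) ξ‖ ^ 2 := by
    intro ξ
    have e1 : ∀ j, ‖hatS (pureDeriv (n + 1) (some j) f) ξ‖ =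
        |ξ j| ^ (n + 1) * ‖hatS f ξ‖ := by
      intro j
      simp [pureDeriv, hatS_Dw]
    rw [Fintype.sum_option]
    simp only [e1]
    have e2 : ‖hatS (pureDeriv (n + 1) none f) ξ‖ = ‖hatS f ξ‖ := rfl
    rw [e2]
    have e3 : (1 : ℝ) + ∑ j, |ξ j| ^ (n + 1) ≤
        (n + 1) * (1 + ∑ j, (|ξ j| ^ (n + 1)) ^ 2) := by
      have : ∑ j, |ξ j| ^ (n + 1) ≤ ∑ j, (1 + (|ξ j| ^ (n + 1)) ^ 2) := by
        gcongr with j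
        nlinarith [sq_nonneg (|ξ j| ^ (n + 1) - 1)]
      rw [Finset.sum_add_distrib] at this
      simp only [Finset.sum_const, Finset.card_univ, Fintype.card_fin, nsmul_eq_mul,
        mul_one] at this
      have h0 : 0 ≤ (n : ℝ) * ∑ j, (|ξ j| ^ (n + 1)) ^ 2 := by positivity
      nlinarith
    calc (1 + ‖ξ‖) ^ (n + 1) * ‖hatS f ξ‖ ^ 2
        ≤ (C * ((n + 1) * (1 + ∑ j, (|ξ j| ^ (n + 1)) ^ 2))) * ‖hatS f ξ‖ ^ 2 := by
          gcongr
          exact (hpow ξ).trans (by gcongr)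
      _ = _ := by
          simp only [mul_pow, ← Finset.sum_mul]
          ring
  -- Cauchy–Schwarz in the form 2ab ≤ ta² + b²/t, with t still free.
  have hbound : ∀ t : ℝ, 0 < t →
      S ≤ (t * I + t⁻¹ * (C * (n + 1) * ((2 * Real.pi) ^ n * Q))) / 2 := by
    intro t ht
    have hi2 : Integrable fun ξ => ∑ i, ‖hatS (pureDeriv (n + 1) i f) ξ‖ ^ 2 :=
      integrable_finsetSum _ fun i _ => integrable_norm_sq _
    rw [← hQ', ← integral_finsetSum _ fun i _ => integrable_norm_sq _, hI, hS,
      ← integral_const_mul, ← integral_const_mul, ← integral_const_mul, ← integral_add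
      (hint.const_mul t) ((hi2.const_mul _).const_mul _), ← integral_div]
    apply integral_mono (hatS f).integrable.norm
      (((hint.const_mul t).add ((hi2.const_mul _).const_mul _)).div_const 2)
    intro ξ
    have h0 : 0 < 1 + ‖ξ‖ := by positivity
    simp only [Pi.add_apply, Real.rpow_neg h0.le, Real.rpow_natCast]
    set p := (1 + ‖ξ‖) ^ (n + 1) with hp
    have hp0 : 0 < p := by positivity
    have h1 := mul_le_mul_of_nonneg_left (hpt ξ) (inv_nonneg.2 ht.le)
    have h2 : 2 * ‖hatS f ξ‖ ≤ t * p⁻¹ + t⁻¹ * (p * ‖hatS f ξ‖ ^ 2) := by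
      have : t * p⁻¹ + t⁻¹ * (p * ‖hatS f ξ‖ ^ 2) - 2 * ‖hatS f ξ‖ =
          (t * p)⁻¹ * (t - p * ‖hatS f ξ‖) ^ 2 := by
        field_simp
        ring
      have h3 : 0 ≤ (t * p)⁻¹ * (t - p * ‖hatS f ξ‖) ^ 2 := by positivity
      linarith
    linarith
  set R := C * (n + 1) * ((2 * Real.pi) ^ n * Q) with hR
  have hR0 : 0 ≤ R := by positivity
  have hSR : S ^ 2 ≤ (I + 1) * R := by
    rcases hS0.eq_or_lt with h | h
    · rw [← h]
      simp only [ne_eq, OfNat.ofNat_ne_zero, not_false_eq_true, zero_pow]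
      positivity
    -- This t makes the first term at most S, which is absorbed on the left; I + 1 in place of I
    -- avoids a division by zero.
    · have h1 := hbound (S / (I + 1)) (by positivity)
      have h2 : S / (I + 1) * I ≤ S := by
        rw [div_mul_eq_mul_div, div_le_iff₀ (by positivity)]
        nlinarith
      rw [inv_div] at h1
      have h3 : S ≤ (I + 1) / S * R := by linarith
      rw [div_mul_eq_mul_div, le_div_iff₀ h] at h3
      nlinarith
  calc ‖f x‖ ^ 2 ≤ S ^ 2 := by gcongr
    _ ≤ (I + 1) * R := hSR
    _ = _ := by rw [hR]; ring

/-- Of the factor 12 = 2 · 6, the 2 pays for the commutator terms and the 6 for passing to `yft`;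
the shift m makes room for the Sobolev derivatives. -/
lemma pow_mul_yf_le_yft (hω : IsWeight ω) {lam : ℝ} (hlam : 0 < lam) (m : ℕ) :
    ∃ mu C : ℝ, 0 < mu ∧ 0 < C ∧ ∀ k, 2 ^ (k + m) * yf ω lam k ≤ C * yft ω mu (k + m) := by
  obtain ⟨mu₁, C₁, hmu₁, hC₁, h₁⟩ := yf_le_yf_add hω hlam m
  obtain ⟨mu₂, C₂, hmu₂, hC₂, h₂⟩ := pow_mul_yf_le_yf hω (A := 12) (by norm_num) hmu₁
  obtain ⟨C₃, hC₃, h₃⟩ := yf_le_pow_mul_yft hω hmu₂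
  refine ⟨mu₂, C₁ * C₂ * C₃, hmu₂, by positivity, fun k => ?_⟩
  have e : (12 : ℝ) ^ (k + m) = 2 ^ (k + m) * 6 ^ (k + m) := by rw [← mul_pow]; norm_num
  have h4 := (h₂ (k + m)).trans (mul_le_mul_of_nonneg_left (h₃ (k + m)) hC₂.le)
  rw [e] at h4
  have h5 : 6 ^ (k + m) * (2 ^ (k + m) * yf ω mu₁ (k + m)) ≤
      6 ^ (k + m) * (C₂ * C₃ * yft ω mu₂ (k + m)) := by linarith
  have h6 := le_of_mul_le_mul_left h5 (by positivity)
  calc 2 ^ (k + m) * yf ω lam k ≤ 2 ^ (k + m) * (C₁ * yf ω mu₁ (k + m)) := by gcongr; exact h₁ k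
    _ = C₁ * (2 ^ (k + m) * yf ω mu₁ (k + m)) := by ring
    _ ≤ C₁ * (C₂ * C₃ * yft ω mu₂ (k + m)) := by gcongr
    _ = _ := by ring

lemma nX_append (w w' : List (Fin n ⊕ Fin n)) : nX (w ++ w') = nX w + nX w' :=
  List.countP_append

lemma nD_append (w w' : List (Fin n ⊕ Fin n)) : nD (w ++ w') = nD w + nD w' :=
  List.countP_append

/-- The letters are symmetric for the L² product, so ‖wu‖² = ⟨u, w.reverse w u⟩ up to conjugation,
and both letter counts double. -/
lemma integral_norm_sq_act_le (u : 𝓢(E n, ℂ)) {F : ℕ → ℝ} (hF0 : ∀ k, 0 ≤ F k)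
    (hF : ∀ k : ℕ, ((k : ℝ) + 1) * F (k + 1) ≤ F k) {K : ℝ}
    (base : ∀ b a : List (Fin n),
      ‖ip (Xw b u) (Dw a u)‖ * (F b.length * F a.length) ≤ K)
    (w : List (Fin n ⊕ Fin n)) :
    (∫ x, ‖act w u x‖ ^ 2) * (F (2 * nX w) * F (2 * nD w)) ≤ 2 ^ (2 * nD w) * K := by
  have h := norm_ip_word_le u hF0 hF base (w.reverse ++ w) [] []
  have e1 : nX (w.reverse ++ w) = 2 * nX w := by
    rw [nX_append, nX, List.countP_reverse, ← nX, two_mul]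
  have e2 : nD (w.reverse ++ w) = 2 * nD w := by
    rw [nD_append, nD, List.countP_reverse, ← nD, two_mul]
  rw [e1, e2, act_append] at h
  simp only [Xw_nil, Dw_nil, List.length_nil, zero_add] at h
  rw [← ip_act, norm_ip_self] at h
  exact h

theorem norm_Xw_Dw_mul_yf_le (hω : IsWeight ω) (n : ℕ) {lam : ℝ} (hlam : 0 < lam) :
    ∃ mu C : ℝ, 0 < mu ∧ 0 < C ∧ ∀ (u : 𝓢(E n, ℂ)) (A B : ℝ), ExpBound ω mu u A →
      ExpBound ω mu (hatS u) B → ∀ (b a : List (Fin n)) (x : E n),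
        ‖Xw b (Dw a u) x‖ * yf ω lam a.length * yf ω lam b.length ≤ C * (A + B) := by
  obtain ⟨C₀, hC₀, hsob⟩ := norm_sq_le_sum n
  set m := 2 * (n + 1) with hm
  obtain ⟨M, C₁, hM, hC₁, h₁⟩ := pow_mul_yf_le_yft hω (lam := lam + lam) (by positivity) m
  obtain ⟨mu₂, C₂, hmu₂, hC₂, h₂⟩ := integral_Xw_mul_yf_le hω n hM
  obtain ⟨mu₃, C₃, hmu₃, hC₃, h₃⟩ := norm_Dw_mul_yf_le hω n hM
  set H := C₀ * (n + 1) * C₁ ^ 2 * (C₂ * C₃) with hH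
  have hH0 : 0 < H := by positivity
  refine ⟨max mu₂ mu₃, Real.sqrt H, lt_max_of_lt_left hmu₂, Real.sqrt_pos.2 hH0,
    fun u A B hA hB b a x => ?_⟩
  have hA0 := hA.nonneg
  have hB0 := hB.nonneg
  have base : ∀ b a : List (Fin n), ‖ip (Xw b u) (Dw a u)‖ *
      (yft ω M b.length * yft ω M a.length) ≤ C₂ * C₃ * (A * B) := by
    intro b a
    have hp := h₂ u A (hA.anti hω (le_max_left _ _)) b
    have hq := h₃ u B (hB.anti hω (le_max_right _ _)) a
    have hya := yf_nonneg ω M a.length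
    have hyb := yf_nonneg ω M b.length
    have hle : yft ω M b.length * yft ω M a.length ≤ yf ω M b.length * yf ω M a.length :=
      mul_le_mul (yft_le_yf _ _ _) (yft_le_yf _ _ _) (yft_nonneg _ _ _) hyb
    refine (mul_le_mul_of_nonneg_left hle (norm_nonneg _)).trans ?_
    -- If the factor vanishes, it gives no bound on D^a u, but the product to be estimated is then
    -- 0.
    rcases hya.eq_or_lt with h0 | h0
    · rw [← h0]
      simp only [mul_zero]
      positivity
    · have h := norm_ip_le (Xw b u) (Dw a u) (M := C₃ * B / yf ω M a.length)
        fun x => (le_div_iff₀ h0).2 (hq x)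
      calc _ ≤ (∫ x, ‖Xw b u x‖) * (C₃ * B / yf ω M a.length) *
            (yf ω M b.length * yf ω M a.length) :=
          mul_le_mul_of_nonneg_right h (by positivity)
        _ = ((∫ x, ‖Xw b u x‖) * yf ω M b.length) * (C₃ * B) := by field_simp
        _ ≤ (C₂ * A) * (C₃ * B) := by gcongr
        _ = _ := by ring
  set K := C₂ * C₃ * (A * B) with hK
  set f := Xw b (Dw a u) with hf
  set l := b.length with hl
  set k := a.length with hk
  have hF0 := yft_nonneg ω M
  have hi : ∀ i : Option (Fin n), (∫ y, ‖pureDeriv (n + 1) i f y‖ ^ 2) *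
      (yft ω M (2 * l) * yft ω M (2 * k + m)) ≤ 2 ^ (2 * k + m) * K := by
    intro i
    set d : List (Fin n) := i.elim [] fun j => List.replicate (n + 1) j with hd
    have hdl : d.length ≤ n + 1 := by cases i <;> simp [hd]
    set w : List (Fin n ⊕ Fin n) := d.map Sum.inr ++ (b.map Sum.inl ++ a.map Sum.inr) with hw
    have e1 : act w u = pureDeriv (n + 1) i f := by
      rw [hw, act_append, act_append, act_map_inl, act_map_inr, act_map_inr]
      rfl
    have e2 : nX w = l := by
      simp [hw, nX, List.countP_map, Function.comp_def, hl]
    have e3 : nD w = d.length + k := by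
      simp [hw, nD, List.countP_map, Function.comp_def, hk]
    have h := integral_norm_sq_act_le u hF0 (mul_yft_succ_le ω M) base w
    rw [e1, e2, e3] at h
    -- The Sobolev derivative has order 0 or n + 1; antitonicity of `yft` brings both to the index
    -- 2k + m.
    have hle : 2 * (d.length + k) ≤ 2 * k + m := by omega
    have hint : 0 ≤ ∫ y, ‖pureDeriv (n + 1) i f y‖ ^ 2 := integral_nonneg fun y => by positivity
    refine le_trans (mul_le_mul_of_nonneg_left (mul_le_mul_of_nonneg_left
      (yft_antitone ω M hle) (hF0 _)) hint) (h.trans ?_)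
    have : (2 : ℝ) ^ (2 * (d.length + k)) ≤ 2 ^ (2 * k + m) :=
      pow_le_pow_right₀ one_le_two hle
    gcongr
  have hsq : ‖f x‖ ^ 2 * (yft ω M (2 * l) * yft ω M (2 * k + m)) ≤
      C₀ * ((n + 1) * (2 ^ (2 * k + m) * K)) := by
    calc _ ≤ (C₀ * ∑ i, ∫ y, ‖pureDeriv (n + 1) i f y‖ ^ 2) *
          (yft ω M (2 * l) * yft ω M (2 * k + m)) :=
        mul_le_mul_of_nonneg_right (hsob f x) (mul_nonneg (hF0 _) (hF0 _))
      _ = C₀ * ∑ i, (∫ y, ‖pureDeriv (n + 1) i f y‖ ^ 2) *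
          (yft ω M (2 * l) * yft ω M (2 * k + m)) := by rw [mul_assoc, Finset.sum_mul]
      _ ≤ C₀ * ∑ _i : Option (Fin n), 2 ^ (2 * k + m) * K := by
          exact mul_le_mul_of_nonneg_left (Finset.sum_le_sum fun i _ => hi i) hC₀.le
      _ = _ := by simp
  have hyl : yf ω lam l ^ 2 ≤ C₁ * yft ω M (2 * l) := by
    calc yf ω lam l ^ 2 ≤ yf ω (lam + lam) (2 * l) := by
          rw [sq, two_mul]; exact yf_mul_le _ _ _ _
      _ ≤ 2 ^ (2 * l + m) * yf ω (lam + lam) (2 * l) :=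
          le_mul_of_one_le_left (yf_nonneg _ _ _) (one_le_pow₀ one_le_two)
      _ ≤ C₁ * yft ω M (2 * l + m) := h₁ _
      _ ≤ _ := mul_le_mul_of_nonneg_left (yft_antitone ω M (Nat.le_add_right _ _)) hC₁.le
  have hyk : 2 ^ (2 * k + m) * yf ω lam k ^ 2 ≤ C₁ * yft ω M (2 * k + m) := by
    refine le_trans ?_ (h₁ _)
    gcongr
    rw [sq, two_mul]
    exact yf_mul_le _ _ _ _
  have hfin : (‖f x‖ * yf ω lam k * yf ω lam l) ^ 2 ≤ H * (A * B) := by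
    have hp : (0 : ℝ) < 2 ^ (2 * k + m) := by positivity
    refine le_of_mul_le_mul_left ?_ hp
    calc 2 ^ (2 * k + m) * (‖f x‖ * yf ω lam k * yf ω lam l) ^ 2
        = ‖f x‖ ^ 2 * (2 ^ (2 * k + m) * yf ω lam k ^ 2 * yf ω lam l ^ 2) := by ring
      _ ≤ ‖f x‖ ^ 2 * (C₁ * yft ω M (2 * k + m) * (C₁ * yft ω M (2 * l))) := by
          have := hF0 (2 * k + m)
          gcongr
      _ = C₁ ^ 2 * (‖f x‖ ^ 2 * (yft ω M (2 * l) * yft ω M (2 * k + m))) := by ring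
      _ ≤ C₁ ^ 2 * (C₀ * ((n + 1) * (2 ^ (2 * k + m) * K))) := by gcongr
      _ = _ := by rw [hK, hH]; ring
  -- The product AB is at most (A + B)².
  refine abs_le_of_sq_le_sq' (le_trans hfin ?_) (by positivity) |>.2
  rw [mul_pow, Real.sq_sqrt hH0.le]
  gcongr
  nlinarith

end Mixed

/-! ### Schwartz regularity of the elements of the space -/

section Regularity

variable {n : ℕ} {ω : ℝ → ℝ}

/-- Iterated derivatives of functions along a list of directions. -/
def Djw (a : List (Fin n)) (f : E n → ℂ) : E n → ℂ := a.foldr Dj f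

@[simp] lemma Djw_nil (f : E n → ℂ) : Djw [] f = f := rfl
@[simp] lemma Djw_cons (j : Fin n) (a : List (Fin n)) (f : E n → ℂ) :
    Djw (j :: a) f = Dj j (Djw a f) := rfl

lemma Djw_append (a a' : List (Fin n)) (f : E n → ℂ) : Djw (a ++ a') f = Djw a (Djw a' f) :=
  List.foldr_append

lemma Djw_word (α : Fin n → ℕ) (f : E n → ℂ) : Djw (word α) f = D α f := by
  rw [word, D]
  induction List.finRange n with
  | nil => rfl
  | cons j l ih =>
    rw [List.flatMap_cons, Djw_append, List.foldr_cons, ← ih]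
    generalize Djw (List.flatMap (fun j => List.replicate (α j) j) l) f = g
    induction α j with
    | zero => rfl
    | succ k ihk => rw [List.replicate_succ, Djw_cons, ihk, Function.iterate_succ_apply']

lemma coe_Dw (a : List (Fin n)) (f : 𝓢(E n, ℂ)) : ⇑(Dw a f) = Djw a ⇑f := by
  induction a with
  | nil => rfl
  | cons j a ih => rw [Dw_cons, coe_Dop, ih, Djw_cons]

lemma coe_Dw_word (α : Fin n → ℕ) (f : 𝓢(E n, ℂ)) : ⇑(Dw (word α) f) = D α ⇑f := by
  rw [coe_Dw, Djw_word]

lemma Dj_eq {f : E n → ℂ} (hf : ContDiff ℝ ((⊤ : ℕ∞) : WithTop ℕ∞) f) (j : Fin n) :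
    Dj j f = fun x => -Complex.I * fderiv ℝ f x (EuclideanSpace.single j 1) := by
  ext x
  rw [Dj, ((hf.differentiable (by simp)) x).lineDeriv_eq_fderiv]

lemma contDiff_Dj {f : E n → ℂ} (hf : ContDiff ℝ ((⊤ : ℕ∞) : WithTop ℕ∞) f) (j : Fin n) :
    ContDiff ℝ ((⊤ : ℕ∞) : WithTop ℕ∞) (Dj j f) := by
  rw [Dj_eq hf]
  exact contDiff_const.mul ((hf.fderiv_right (by simp)).clm_apply contDiff_const)

lemma contDiff_Djw {f : E n → ℂ} (hf : ContDiff ℝ ((⊤ : ℕ∞) : WithTop ℕ∞) f)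
    (a : List (Fin n)) : ContDiff ℝ ((⊤ : ℕ∞) : WithTop ℕ∞) (Djw a f) := by
  induction a with
  | nil => exact hf
  | cons j a ih => exact contDiff_Dj ih j

lemma Dj_comm {f : E n → ℂ} (hf : ContDiff ℝ ((⊤ : ℕ∞) : WithTop ℕ∞) f) (i j : Fin n) :
    Dj i (Dj j f) = Dj j (Dj i f) := by
  have h : ∀ i j : Fin n, ∀ x, Dj i (Dj j f) x = -Complex.I * (-Complex.I *
      fderiv ℝ (fderiv ℝ f) x (EuclideanSpace.single i 1) (EuclideanSpace.single j 1)) := by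
    intro i j x
    have hd : DifferentiableAt ℝ (fderiv ℝ f) x :=
      ((hf.fderiv_right (m := ((⊤ : ℕ∞) : WithTop ℕ∞)) (by simp)).differentiable (by simp)) x
    rw [Dj_eq (contDiff_Dj hf j), Dj_eq hf]
    have h1 : HasFDerivAt (fun y => -Complex.I * fderiv ℝ f y (EuclideanSpace.single j 1)) _ x :=
      ((hd.hasFDerivAt).clm_apply (hasFDerivAt_const (EuclideanSpace.single j 1) x)).const_mul
        (-Complex.I)
    simp only [h1.fderiv]
    simp
  ext x
  rw [h, h]
  have hs : IsSymmSndFDerivAt ℝ f x := hf.contDiffAt.isSymmSndFDerivAt (by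
    rw [minSmoothness_of_isRCLikeNormedField]
    exact WithTop.coe_le_coe.2 (le_top : (2 : ℕ∞) ≤ ⊤))
  rw [hs.eq]

lemma Djw_perm {f : E n → ℂ} (hf : ContDiff ℝ ((⊤ : ℕ∞) : WithTop ℕ∞) f)
    {a a' : List (Fin n)} (h : a.Perm a') : Djw a f = Djw a' f := by
  induction h with
  | nil => rfl
  | cons j _ ih => rw [Djw_cons, ih, Djw_cons]
  | swap i j l => exact Dj_comm (contDiff_Djw hf l) j i
  | trans _ _ ih₁ ih₂ => rw [ih₁, ih₂]

lemma count_word (α : Fin n → ℕ) (j : Fin n) : (word α).count j = α j := by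
  rw [word, List.count_flatMap]
  simp [Function.comp_def, List.count_replicate, ← List.ofFn_eq_map, List.sum_ofFn]

lemma Djw_eq_D {f : E n → ℂ} (hf : ContDiff ℝ ((⊤ : ℕ∞) : WithTop ℕ∞) f)
    (a : List (Fin n)) : Djw a f = D (fun j => a.count j) f := by
  rw [← Djw_word]
  apply Djw_perm hf
  rw [List.perm_iff_count]
  intro j
  rw [count_word]

lemma fderiv_eq_sum {f : E n → ℂ} (hf : ContDiff ℝ ((⊤ : ℕ∞) : WithTop ℕ∞) f) :
    fderiv ℝ f = fun x => ∑ j : Fin n,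
      ((ContinuousLinearMap.smulRightL ℝ (E n) ℂ (EuclideanSpace.proj j)).comp
        (ContinuousLinearMap.mul ℝ ℂ Complex.I)) (Dj j f x) := by
  ext x v
  have hv : v = ∑ j, v j • (EuclideanSpace.single j (1 : ℝ) : E n) := by
    ext i
    simp [Pi.single_apply]
  conv_lhs => rw [hv]
  rw [map_sum, sum_apply]
  apply Finset.sum_congr rfl
  intro j _
  rw [Dj_eq hf]
  simp [← mul_assoc]

/-- Induction on the order through df = Σ i D_j f dx_j, which reduces full derivatives to words in
the D_j. -/
lemma decay_iteratedFDeriv (m : ℕ) : ∀ {f : E n → ℂ},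
    ContDiff ℝ ((⊤ : ℕ∞) : WithTop ℕ∞) f →
    (∀ (k : ℕ) (a : List (Fin n)), ∃ C, ∀ x, ‖x‖ ^ k * ‖Djw a f x‖ ≤ C) →
    ∀ k : ℕ, ∃ C, ∀ x, ‖x‖ ^ k * ‖iteratedFDeriv ℝ m f x‖ ≤ C := by
  induction m with
  | zero =>
    intro f _ h k
    simpa using h k []
  | succ m ih =>
    intro f hf h k
    have h1 : ∀ j : Fin n, ∃ C, ∀ x, ‖x‖ ^ k * ‖iteratedFDeriv ℝ m (Dj j f) x‖ ≤ C := fun j =>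
      ih (contDiff_Dj hf j) (fun k a => by
        obtain ⟨C, hC⟩ := h k (a ++ [j])
        exact ⟨C, fun x => by rw [Djw_append] at hC; exact hC x⟩) k
    choose C hC using h1
    set L : Fin n → ℂ →L[ℝ] (E n →L[ℝ] ℂ) := fun j =>
      (ContinuousLinearMap.smulRightL ℝ (E n) ℂ (EuclideanSpace.proj j)).comp
        (ContinuousLinearMap.mul ℝ ℂ Complex.I) with hL
    refine ⟨∑ j, ‖L j‖ * C j, fun x => ?_⟩
    have hcd : ∀ j, ContDiff ℝ (m : WithTop ℕ∞) (Dj j f) := fun j =>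
      (contDiff_Dj hf j).of_le (by exact_mod_cast le_top)
    have h2 : iteratedFDeriv ℝ m (fderiv ℝ f) x =
        ∑ j, (L j).compContinuousMultilinearMap (iteratedFDeriv ℝ m (Dj j f) x) := by
      rw [fderiv_eq_sum hf]
      refine (iteratedFDeriv_fun_sum_apply (f := fun j x => L j (Dj j f x)) fun j _ =>
        ((L j).contDiff.comp (hcd j)).contDiffAt).trans ?_
      apply Finset.sum_congr rfl
      intro j _
      exact (L j).iteratedFDeriv_comp_left (hcd j).contDiffAt le_rfl
    rw [← norm_iteratedFDeriv_fderiv, h2]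
    calc _ ≤ ‖x‖ ^ k * ∑ j, ‖L j‖ * ‖iteratedFDeriv ℝ m (Dj j f) x‖ := by
          gcongr
          refine (norm_sum_le _ _).trans (Finset.sum_le_sum fun j _ => ?_)
          exact ContinuousLinearMap.norm_compContinuousMultilinearMap_le _ _
      _ = ∑ j, ‖L j‖ * (‖x‖ ^ k * ‖iteratedFDeriv ℝ m (Dj j f) x‖) := by
          rw [Finset.mul_sum]
          exact Finset.sum_congr rfl fun j _ => by ring
      _ ≤ _ := by
          gcongr with j
          exact hC j x

lemma ofReal_mul_enorm (c : ℝ) (hc : 0 ≤ c) (z : ℂ) :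
    ENNReal.ofReal c * ‖z‖ₑ = ENNReal.ofReal (c * ‖z‖) := by
  rw [ENNReal.ofReal_mul hc, ofReal_norm]

lemma expBound_toReal {lam : ℝ} {f : E n → ℂ} (h : expSup ω lam f ≠ ∞) :
    ExpBound ω lam f (expSup ω lam f).toReal := fun x => by
  rw [← ENNReal.ofReal_le_iff_le_toReal h, ← ofReal_mul_enorm _ (Real.exp_pos _).le]
  exact le_iSup (fun x : E n => ENNReal.ofReal (Real.exp (lam * ω ‖x‖)) * ‖f x‖ₑ) x

lemma expSup_le {lam A : ℝ} {f : E n → ℂ} (h : ExpBound ω lam f A) :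
    expSup ω lam f ≤ ENNReal.ofReal A :=
  iSup_le fun x => by
    rw [ofReal_mul_enorm _ (Real.exp_pos _).le]
    exact ENNReal.ofReal_le_ofReal (h x)

/-- By (γ) exponential decay beats every power of |x|. Symmetry of second derivatives reorders any
word into some D^α, to which the definition of the space applies. -/
lemma exists_schwartz (hω : IsWeight ω) {u : E n → ℂ} (hu : u ∈ Space n ω) :
    ∃ f : 𝓢(E n, ℂ), ⇑f = u := by
  obtain ⟨-, hs, -, h, -⟩ := hu
  refine ⟨⟨u, hs, fun k m => decay_iteratedFDeriv m hs (fun k a => ?_) k⟩, rfl⟩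
  obtain ⟨c, C, hc, hC, hpow⟩ := hω.pow_le_exp k
  have hb := expBound_toReal (h c hc fun j => a.count j).ne
  refine ⟨C * _, fun x => le_trans ?_ (mul_le_mul_of_nonneg_left (hb x) hC.le)⟩
  rw [← Djw_eq_D hs, ← mul_assoc]
  gcongr
  refine le_trans ?_ (hpow ‖x‖ (norm_nonneg x))
  gcongr
  linarith

end Regularity

/-! ### Domination of the families of seminorms -/

section Domination

open MeasureTheory

variable {n : ℕ} {ω : ℝ → ℝ}

lemma DominatedOn.mono_set {S S' : Set (E n → ℂ)} {P Q : Set ((E n → ℂ) → ℝ≥0∞)}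
    (h : DominatedOn S P Q) (hS : S' ⊆ S) : DominatedOn S' P Q := fun p hp => by
  obtain ⟨T, hT, C, hC⟩ := h p hp
  exact ⟨T, hT, C, fun u hu => hC u (hS hu)⟩

lemma DominatedOn.refl (S : Set (E n → ℂ)) (P : Set ((E n → ℂ) → ℝ≥0∞)) :
    DominatedOn S P P := fun p hp =>
  ⟨{p}, by simpa using hp, 1, fun u _ => by simp⟩

lemma DominatedOn.trans {S : Set (E n → ℂ)} {P Q R : Set ((E n → ℂ) → ℝ≥0∞)}
    (h : DominatedOn S P Q) (h' : DominatedOn S Q R) : DominatedOn S P R := by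
  classical
  intro p hp
  obtain ⟨T, hT, C, hC⟩ := h p hp
  choose! T' hT' C' hC' using h'
  refine ⟨T.biUnion T', ?_, C * T.sup C', fun u hu => (hC u hu).trans ?_⟩
  · intro q hq
    simp only [Finset.coe_biUnion, Set.mem_iUnion] at hq
    obtain ⟨r, hr, hq⟩ := hq
    exact hT' r (hT hr) hq
  · rw [ENNReal.coe_mul, mul_assoc]
    gcongr
    apply Finset.sup_le
    intro q hq
    refine (hC' q (hT hq) u hu).trans ?_
    gcongr
    · exact Finset.le_sup (f := C') hq
    · exact Finset.subset_biUnion_of_mem T' hq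

/-- Reduces domination to a real inequality when the dominating seminorms are finite; replacing
their sum by the maximum costs the number of terms. -/
lemma dominatedOn_of_sum {S : Set (E n → ℂ)} {P Q : Set ((E n → ℂ) → ℝ≥0∞)}
    (h : ∀ p ∈ P, ∃ (ι : Type) (_ : Fintype ι) (q : ι → (E n → ℂ) → ℝ≥0∞) (C : ℝ),
      (∀ i, q i ∈ Q) ∧ 0 < C ∧ ∀ u ∈ S, (∀ i, q i u ≠ ∞) →
        p u ≤ ENNReal.ofReal (C * ∑ i, (q i u).toReal)) : DominatedOn S P Q := by
  classical
  intro p hp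
  obtain ⟨ι, _, q, C, hq, hC, h⟩ := h p hp
  refine ⟨Finset.univ.image q, ?_, C.toNNReal * Fintype.card ι, fun u hu => ?_⟩
  · intro r hr
    simp only [Finset.coe_image, Finset.coe_univ, Set.image_univ, Set.mem_range] at hr
    obtain ⟨i, rfl⟩ := hr
    exact hq i
  have hle : ∀ i, q i u ≤ (Finset.univ.image q).sup fun q => q u := fun i =>
    Finset.le_sup (f := fun q => q u) (Finset.mem_image_of_mem q (Finset.mem_univ i))
  by_cases hfin : ∀ i, q i u ≠ ∞
  · refine (h u hu hfin).trans ?_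
    rw [ENNReal.ofReal_mul hC.le, ENNReal.coe_mul, mul_assoc]
    gcongr
    · rfl
    · rw [ENNReal.ofReal_sum_of_nonneg fun i _ => ENNReal.toReal_nonneg]
      calc _ ≤ ∑ _i : ι, (Finset.univ.image q).sup fun q => q u := by
            gcongr with i
            rw [ENNReal.ofReal_toReal (hfin i)]
            exact hle i
        _ = _ := by simp
  -- One infinite seminorm makes the right side ∞, since the constant is positive.
  · push Not at hfin
    obtain ⟨i, hi⟩ := hfin
    have htop : ((Finset.univ.image q).sup fun q => q u) = ∞ := top_le_iff.1 (hi ▸ hle i)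
    have : Nonempty ι := ⟨i⟩
    rw [htop, ENNReal.mul_top]
    · exact le_top
    · simp [hC]

/-- The Schwartz functions. -/
def Sch (n : ℕ) : Set (E n → ℂ) := Set.range fun f : 𝓢(E n, ℂ) => (f : E n → ℂ)

@[simp] lemma D_zero (f : E n → ℂ) : D 0 f = f := by
  rw [D]
  induction List.finRange n with
  | nil => rfl
  | cons j l ih => rw [List.foldr_cons, ih]; rfl

@[simp] lemma mulMono_zero (f : E n → ℂ) : mulMono 0 f = f := by
  ext x
  simp [mulMono, mono]

lemma dominatedOn_of_subset {S : Set (E n → ℂ)} {P Q : Set ((E n → ℂ) → ℝ≥0∞)}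
    (h : P ⊆ Q) : DominatedOn S P Q := fun p hp =>
  DominatedOn.refl S Q p (h hp)

lemma fam3_subset_fam1 : Fam3 n ω ⊆ Fam1 n ω := by
  rintro p ⟨lam, hlam, h⟩
  exact ⟨lam, hlam, 0, by simpa using h⟩

lemma fam3_subset_fam2 : Fam3 n ω ⊆ Fam2 n ω := by
  rintro p ⟨lam, hlam, h⟩
  exact ⟨lam, hlam, 0, by simpa using h⟩

/-- The pair of seminorms of the third family with a given parameter. -/
def pair3 (ω : ℝ → ℝ) (lam : ℝ) (b : Bool) (u : E n → ℂ) : ℝ≥0∞ :=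
  cond b (expSup ω lam u) (expSup ω lam (hat u))

lemma pair3_mem {lam : ℝ} (hlam : 0 < lam) (b : Bool) : pair3 ω lam b ∈ Fam3 n ω := by
  cases b
  · exact ⟨lam, hlam, Or.inr rfl⟩
  · exact ⟨lam, hlam, Or.inl rfl⟩

lemma pair3_bounds {lam : ℝ} {u : 𝓢(E n, ℂ)} (h : ∀ b, pair3 ω lam b ⇑u ≠ ∞) :
    ExpBound ω lam u (pair3 ω lam true ⇑u).toReal ∧
      ExpBound ω lam (hatS u) (pair3 ω lam false ⇑u).toReal := by
  refine ⟨expBound_toReal (h true), ?_⟩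
  rw [coe_hatS]
  exact expBound_toReal (h false)

lemma dominatedOn_fam3 {P : Set ((E n → ℂ) → ℝ≥0∞)}
    (h : ∀ p ∈ P, ∃ mu C : ℝ, 0 < mu ∧ 0 < C ∧ ∀ (u : 𝓢(E n, ℂ)) (A B : ℝ),
      ExpBound ω mu u A → ExpBound ω mu (hatS u) B → p u ≤ ENNReal.ofReal (C * (A + B))) :
    DominatedOn (Sch n) P (Fam3 n ω) := by
  apply dominatedOn_of_sum
  intro p hp
  obtain ⟨mu, C, hmu, hC, h⟩ := h p hp
  refine ⟨Bool, inferInstance, pair3 ω mu, C, pair3_mem hmu, hC, ?_⟩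
  rintro _ ⟨u, rfl⟩ hfin
  obtain ⟨h1, h2⟩ := pair3_bounds hfin
  rw [Fintype.sum_bool]
  exact h u _ _ h1 h2

lemma ExpBound.hatS_hatS {lam A : ℝ} {u : 𝓢(E n, ℂ)} (h : ExpBound ω lam u A) :
    ExpBound ω lam (hatS (hatS u)) ((2 * Real.pi) ^ n * A) := fun x => by
  rw [SOmega.hatS_hatS, norm_smul, Real.norm_of_nonneg (by positivity), mul_left_comm]
  have := h (-x)
  rw [norm_neg] at this
  gcongr

lemma fam1_dominated (hω : IsWeight ω) (n : ℕ) : DominatedOn (Sch n) (Fam1 n ω) (Fam3 n ω) := by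
  apply dominatedOn_fam3
  rintro p ⟨lam, hlam, α, h⟩
  obtain ⟨mu, C, hmu, hC, hb⟩ := expBound_Dw hω (word α) lam hlam
  have hpi : 1 ≤ (2 * Real.pi) ^ n := one_le_pow₀ (by linarith [Real.pi_gt_three])
  refine ⟨mu, C * (2 * Real.pi) ^ n, hmu, by positivity, fun u A B hA hB => ?_⟩
  have hA0 := hA.nonneg
  have hB0 := hB.nonneg
  rcases h with rfl | rfl
  · simp only [← coe_Dw_word]
    refine (expSup_le (hb u A B hA hB)).trans (ENNReal.ofReal_le_ofReal ?_)
    rw [mul_assoc]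
    gcongr
    exact le_mul_of_one_le_left (by positivity) hpi
  -- The roles of u and û are exchanged: the transform of û is (2π)^n u(-x).
  · simp only [← coe_hatS, ← coe_Dw_word]
    refine (expSup_le (hb _ _ _ hB hA.hatS_hatS)).trans (ENNReal.ofReal_le_ofReal ?_)
    rw [mul_assoc]
    gcongr
    nlinarith

lemma norm_mulMono_le (α : Fin n → ℕ) (f : E n → ℂ) (x : E n) :
    ‖mulMono α f x‖ ≤ ‖x‖ ^ len α * ‖f x‖ := by
  rw [mulMono, norm_mul, ← prod_word, ← length_word]
  gcongr
  exact norm_coord_prod_le _ _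

lemma expBound_mulMono (hω : IsWeight ω) (n : ℕ) {lam : ℝ} (hlam : 0 < lam) (α : Fin n → ℕ) :
    ∃ mu C : ℝ, 0 < mu ∧ 0 < C ∧ ∀ (f : E n → ℂ) (A : ℝ), ExpBound ω mu f A →
      ExpBound ω lam (mulMono α f) (C * A) := by
  obtain ⟨c, C, hc, hC, hpow⟩ := hω.pow_le_exp (len α)
  refine ⟨lam + c, C, by positivity, hC, fun f A h x => ?_⟩
  have h1 : ‖x‖ ^ len α ≤ C * Real.exp (c * ω ‖x‖) := by
    refine le_trans ?_ (hpow ‖x‖ (norm_nonneg x))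
    gcongr
    linarith
  calc _ ≤ Real.exp (lam * ω ‖x‖) * (‖x‖ ^ len α * ‖f x‖) := by
        gcongr; exact norm_mulMono_le α f x
    _ ≤ Real.exp (lam * ω ‖x‖) * (C * Real.exp (c * ω ‖x‖) * ‖f x‖) := by gcongr
    _ = C * (Real.exp ((lam + c) * ω ‖x‖) * ‖f x‖) := by rw [add_mul, Real.exp_add]; ring
    _ ≤ C * A := by gcongr; exact h x

lemma fam2_dominated (hω : IsWeight ω) (n : ℕ) : DominatedOn (Sch n) (Fam2 n ω) (Fam3 n ω) := by
  apply dominatedOn_fam3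
  rintro p ⟨lam, hlam, α, h⟩
  obtain ⟨mu, C, hmu, hC, hb⟩ := expBound_mulMono hω n hlam α
  refine ⟨mu, C, hmu, hC, fun u A B hA hB => ?_⟩
  have hA0 := hA.nonneg
  have hB0 := hB.nonneg
  rcases h with rfl | rfl
  · refine (expSup_le (hb u A hA)).trans (ENNReal.ofReal_le_ofReal ?_)
    gcongr
    linarith
  · simp only [← coe_hatS]
    refine (expSup_le (hb _ B hB)).trans (ENNReal.ofReal_le_ofReal ?_)
    gcongr
    linarith

lemma enorm_mul_youngFactor {lam : ℝ} (hlam : 0 < lam) (z : ℂ) (k : ℕ) :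
    ‖z‖ₑ * youngFactor ω lam k = ENNReal.ofReal (‖z‖ * yf ω lam k) := by
  rw [youngFactor_eq hlam, ENNReal.ofReal_mul (norm_nonneg _), ofReal_norm]

lemma enorm_mul_youngFactor_mul {lam mu : ℝ} (hlam : 0 < lam) (hmu : 0 < mu) (z : ℂ) (k l : ℕ) :
    ‖z‖ₑ * youngFactor ω lam k * youngFactor ω mu l =
      ENNReal.ofReal (‖z‖ * yf ω lam k * yf ω mu l) := by
  rw [enorm_mul_youngFactor hlam, youngFactor_eq hmu,
    ENNReal.ofReal_mul (mul_nonneg (norm_nonneg _) (yf_nonneg _ _ _))]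

lemma mulMono_D_eq (α β : Fin n → ℕ) (u : 𝓢(E n, ℂ)) :
    mulMono β (D α ⇑u) = ⇑(Xw (word β) (Dw (word α) u)) := by
  rw [coe_Xw_word, coe_Dw_word]

lemma fam5_dominated (hω : IsWeight ω) (n : ℕ) : DominatedOn (Sch n) (Fam5 n ω) (Fam3 n ω) := by
  apply dominatedOn_fam3
  rintro p ⟨mu, lam, hmu, hlam, rfl⟩
  obtain ⟨nu, C, hnu, hC, hb⟩ := norm_Xw_Dw_mul_yf_le hω n (lam := max lam mu)
    (lt_max_of_lt_left hlam)
  refine ⟨nu, C, hnu, hC, fun u A B hA hB => iSup_le fun α => iSup_le fun β => iSup_le fun x => ?_⟩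
  rw [enorm_mul_youngFactor_mul hlam hmu, mulMono_D_eq]
  refine ENNReal.ofReal_le_ofReal (le_trans ?_ (hb u A B hA hB (word β) (word α) x))
  rw [length_word, length_word]
  have h1 := yf_mono hω (le_max_left lam mu) (len α)
  have h2 := yf_mono hω (le_max_right lam mu) (len β)
  have h3 := yf_nonneg ω lam (len α)
  have h4 := yf_nonneg ω mu (len β)
  have h5 := yf_nonneg ω (max lam mu) (len α)
  gcongr

lemma len_add (α β : Fin n → ℕ) : len (α + β) = len α + len β := by
  simp [len, Finset.sum_add_distrib]

/-- A family is dominated by another if each of its members is bounded by a constant times one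
member of the other. -/
lemma dominatedOn_of_single {S : Set (E n → ℂ)} {P Q : Set ((E n → ℂ) → ℝ≥0∞)}
    (h : ∀ p ∈ P, ∃ q ∈ Q, ∃ C : ℝ≥0, ∀ u ∈ S, p u ≤ C * q u) : DominatedOn S P Q := by
  intro p hp
  obtain ⟨q, hq, C, h⟩ := h p hp
  exact ⟨{q}, by simpa using hq, C, by simpa using h⟩

lemma youngFactor_add_le (hω : IsWeight ω) {lam : ℝ} (hlam : 0 < lam) (k l : ℕ) :
    youngFactor ω lam (k + l) ≤ youngFactor ω lam k * youngFactor ω lam l := by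
  rw [youngFactor_eq hlam, youngFactor_eq hlam, youngFactor_eq hlam,
    ← ENNReal.ofReal_mul (yf_nonneg _ _ _)]
  exact ENNReal.ofReal_le_ofReal (yf_add_le hω hlam k l)

lemma youngFactor_mul_le {lam mu : ℝ} (hlam : 0 < lam) (hmu : 0 < mu) (k l : ℕ) :
    youngFactor ω lam k * youngFactor ω mu l ≤ youngFactor ω (lam + mu) (k + l) := by
  rw [youngFactor_eq hlam, youngFactor_eq hmu, youngFactor_eq (add_pos hlam hmu),
    ← ENNReal.ofReal_mul (yf_nonneg _ _ _)]
  exact ENNReal.ofReal_le_ofReal (yf_mul_le lam mu k l)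

lemma fam6_dominated (hω : IsWeight ω) (S : Set (E n → ℂ)) :
    DominatedOn S (Fam6 n ω) (Fam5 n ω) := by
  apply dominatedOn_of_single
  rintro p ⟨lam, hlam, rfl⟩
  refine ⟨_, ⟨lam, lam, hlam, hlam, rfl⟩, 1, fun u _ => ?_⟩
  rw [ENNReal.coe_one, one_mul]
  refine iSup_mono fun α => iSup_mono fun β => iSup_mono fun x => ?_
  rw [mul_assoc, len_add]
  gcongr
  exact youngFactor_add_le hω hlam _ _

lemma fam5_dominated_fam6 (S : Set (E n → ℂ)) :
    DominatedOn S (Fam5 n ω) (Fam6 n ω) := by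
  apply dominatedOn_of_single
  rintro p ⟨mu, lam, hmu, hlam, rfl⟩
  refine ⟨_, ⟨lam + mu, add_pos hlam hmu, rfl⟩, 1, fun u _ => ?_⟩
  rw [ENNReal.coe_one, one_mul]
  refine iSup_mono fun α => iSup_mono fun β => iSup_mono fun x => ?_
  rw [mul_assoc, len_add]
  gcongr
  exact youngFactor_mul_le hlam hmu _ _

lemma exists_youngFactor_inv (hω : IsWeight ω) (k : ℕ) :
    ∃ mu : ℝ, 0 < mu ∧ ∃ C : ℝ≥0, 1 ≤ C * youngFactor ω mu k := by
  obtain ⟨mu, hmu, hp⟩ := yf_pos hω k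
  refine ⟨mu, hmu, (1 / yf ω mu k).toNNReal, ?_⟩
  rw [youngFactor_eq hmu]
  change 1 ≤ ENNReal.ofReal _ * _
  rw [← ENNReal.ofReal_mul (by positivity), one_div, inv_mul_cancel₀ hp.ne', ENNReal.ofReal_one]

/-- For the frozen index, a parameter is chosen that makes its factor positive, so that this factor
can be divided out. -/
lemma fam4_dominated (hω : IsWeight ω) (S : Set (E n → ℂ)) :
    DominatedOn S (Fam4 n ω) (Fam5 n ω) := by
  apply dominatedOn_of_single
  rintro p ⟨lam, hlam, ⟨β, rfl⟩ | ⟨α, rfl⟩⟩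
  · obtain ⟨mu, hmu, C, hC⟩ := exists_youngFactor_inv hω (len β)
    refine ⟨_, ⟨mu, lam, hmu, hlam, rfl⟩, C, fun u _ => iSup_le fun α => iSup_le fun x => ?_⟩
    calc ‖mulMono β (D α u) x‖ₑ * youngFactor ω lam (len α)
        ≤ ‖mulMono β (D α u) x‖ₑ * youngFactor ω lam (len α) *
            (C * youngFactor ω mu (len β)) := le_mul_of_one_le_right' hC
      _ = C * (‖mulMono β (D α u) x‖ₑ * youngFactor ω lam (len α) *
            youngFactor ω mu (len β)) := by ring
      _ ≤ _ := by
        gcongr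
        exact le_iSup_of_le α (le_iSup_of_le β (le_iSup_of_le x le_rfl))
  · obtain ⟨mu, hmu, C, hC⟩ := exists_youngFactor_inv hω (len α)
    refine ⟨_, ⟨lam, mu, hlam, hmu, rfl⟩, C, fun u _ => iSup_le fun β => iSup_le fun x => ?_⟩
    calc ‖mulMono β (D α u) x‖ₑ * youngFactor ω lam (len β)
        ≤ ‖mulMono β (D α u) x‖ₑ * youngFactor ω lam (len β) *
            (C * youngFactor ω mu (len α)) := le_mul_of_one_le_right' hC
      _ = C * (‖mulMono β (D α u) x‖ₑ * youngFactor ω mu (len α) *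
            youngFactor ω lam (len β)) := by ring
      _ ≤ _ := by
        gcongr
        exact le_iSup_of_le α (le_iSup_of_le β (le_iSup_of_le x le_rfl))

end Domination

/-! ### Return from the mixed estimates to exponential decay, and the equivalences -/

section Equivalence

open MeasureTheory

variable {n : ℕ} {ω : ℝ → ℝ}

lemma mono_single (j : Fin n) (k : ℕ) (x : E n) : mono (Pi.single j k) x = x j ^ k := by
  rw [mono, Finset.prod_eq_single j]
  · simp
  · intro i _ hi
    simp [hi]
  · simp

lemma len_single (j : Fin n) (k : ℕ) : len (Pi.single j k : Fin n → ℕ) = k := by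
  simp [len]

/-- A power of the largest coordinate suffices, because |x| ≤ n max |x_j| and the dilation by n is
paid by (α). -/
lemma exp_le_mono_mul_yf (hω : IsWeight ω) (n : ℕ) {lam : ℝ} (hlam : 0 < lam) :
    ∃ mu C : ℝ, 0 < mu ∧ 0 < C ∧ ∀ x : E n, ∃ α : Fin n → ℕ,
      Real.exp (lam * ω ‖x‖) ≤ C * (|mono α x| * yf ω mu (len α)) := by
  obtain ⟨lam', C₁, hlam', hC₁, h₁⟩ := hω.exp_dilation n (Nat.cast_nonneg n) hlam
  obtain ⟨mu, C₂, hmu, hC₂, h₂⟩ := exp_le_pow_mul_yf hω hlam'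
  refine ⟨mu, C₁ * C₂ + Real.exp (lam * ω n), hmu, by positivity, fun x => ?_⟩
  by_cases h : ∀ j, |x j| ≤ 1
  · refine ⟨0, ?_⟩
    have hx : ‖x‖ ≤ n := by simpa using norm_le_card_mul h zero_le_one
    have e1 : mono 0 x = 1 := by simp [mono]
    have e2 : len (0 : Fin n → ℕ) = 0 := by simp [len]
    have h3 : 1 ≤ Real.exp (mu * ω 1) :=
      Real.one_le_exp (mul_nonneg hmu.le (hω.nonneg 1 zero_le_one))
    rw [e1, e2, yf_zero hω hmu, abs_one, one_mul]
    calc Real.exp (lam * ω ‖x‖) ≤ Real.exp (lam * ω n) := by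
          gcongr; exact hω.mono_le (norm_nonneg x) hx
      _ ≤ C₁ * C₂ + Real.exp (lam * ω n) := by linarith [mul_pos hC₁ hC₂]
      _ ≤ _ := le_mul_of_one_le_right (by positivity) h3
  · push Not at h
    obtain ⟨i, hi⟩ := h
    have : Nonempty (Fin n) := ⟨i⟩
    obtain ⟨i₀, h₀⟩ := Finite.exists_max fun j => |x j|
    obtain ⟨k, hk⟩ := h₂ |x i₀| (abs_nonneg _)
    refine ⟨Pi.single i₀ k, ?_⟩
    rw [mono_single, len_single, abs_pow]
    have hy := yf_nonneg ω mu k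
    calc Real.exp (lam * ω ‖x‖) ≤ Real.exp (lam * ω (n * |x i₀|)) := by
          gcongr
          exact hω.mono_le (norm_nonneg x) (norm_le_card_mul h₀ (abs_nonneg _))
      _ ≤ C₁ * Real.exp (lam' * ω |x i₀|) := h₁ _ (abs_nonneg _)
      _ ≤ C₁ * (C₂ * (|x i₀| ^ k * yf ω mu k)) := by gcongr
      _ = C₁ * C₂ * (|x i₀| ^ k * yf ω mu k) := by ring
      _ ≤ _ := by
          gcongr
          linarith [Real.exp_pos (lam * ω n)]

/-- The multi-indices `0` and `N e_j`. -/
def pureIndex (N : ℕ) (i : Option (Fin n)) : Fin n → ℕ := i.elim 0 fun j => Pi.single j N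

lemma integral_norm_le_sum (n : ℕ) : ∃ C : ℝ, 0 < C ∧ ∀ (f : 𝓢(E n, ℂ))
    (A : Option (Fin n) → ℝ), (∀ i x, ‖mulMono (pureIndex (n + 1) i) f x‖ ≤ A i) →
      ∫ x, ‖f x‖ ≤ C * ∑ i, A i := by
  obtain ⟨I, hI, hint⟩ := integral_norm_le_of_decay n
  obtain ⟨C, hC, hpow⟩ := one_add_norm_pow_le n (n + 1)
  refine ⟨I * C, by positivity, fun f A h => ?_⟩
  rw [mul_assoc]
  apply hint
  intro x
  calc (1 + ‖x‖) ^ (n + 1) * ‖f x‖ ≤ C * (1 + ∑ j, |x j| ^ (n + 1)) * ‖f x‖ := by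
        gcongr; exact hpow x
    _ = C * ∑ i, ‖mulMono (pureIndex (n + 1) i) f x‖ := by
        rw [Fintype.sum_option, mul_assoc, add_mul, one_mul, Finset.sum_mul]
        simp only [pureIndex, Option.elim_none, Option.elim_some, mulMono_zero]
        simp [mulMono, mono_single]
    _ ≤ _ := by
        gcongr with i
        exact h i x

/-- For each ξ choose α with e^{λω(ξ)} controlled by |ξ^α|, then use |ξ^α û(ξ)| ≤ ‖D^α u‖₁. The L¹
norm needs only the weights 1 and x_j^{n+1}. -/
lemma expBound_hatS_of_sup (hω : IsWeight ω) (n : ℕ) {lam : ℝ} (hlam : 0 < lam) :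
    ∃ mu C : ℝ, 0 < mu ∧ 0 < C ∧ ∀ (u : 𝓢(E n, ℂ)) (A : Option (Fin n) → ℝ),
      (∀ i α x, ‖mulMono (pureIndex (n + 1) i) (D α u) x‖ * yf ω mu (len α) ≤ A i) →
        ExpBound ω lam (hatS u) (C * ∑ i, A i) := by
  obtain ⟨mu, C₁, hmu, hC₁, h₁⟩ := exp_le_mono_mul_yf hω n hlam
  obtain ⟨C₂, hC₂, h₂⟩ := integral_norm_le_sum n
  refine ⟨mu, C₁ * C₂, hmu, by positivity, fun u A h ξ => ?_⟩
  obtain ⟨α, hα⟩ := h₁ ξ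
  have hy := yf_nonneg ω mu (len α)
  have e1 : |mono α ξ| * ‖hatS u ξ‖ = ‖hatS (Dw (word α) u) ξ‖ := by
    rw [hatS_Dw, prod_word, norm_mul, Complex.norm_real, Real.norm_eq_abs]
  have e2 := h₂ ((yf ω mu (len α) : ℂ) • Dw (word α) u) A fun i x => by
    refine le_trans (le_of_eq ?_) (h i α x)
    simp only [mulMono, smul_apply, smul_eq_mul, norm_mul, Complex.norm_real,
      Real.norm_of_nonneg hy, coe_Dw_word]
    ring
  simp only [smul_apply, norm_smul, Complex.norm_real, Real.norm_of_nonneg hy] at e2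
  rw [integral_const_mul] at e2
  calc Real.exp (lam * ω ‖ξ‖) * ‖hatS u ξ‖
      ≤ C₁ * (|mono α ξ| * yf ω mu (len α)) * ‖hatS u ξ‖ := by gcongr
    _ = C₁ * (yf ω mu (len α) * ‖hatS (Dw (word α) u) ξ‖) := by rw [← e1]; ring
    _ ≤ C₁ * (yf ω mu (len α) * ∫ x, ‖Dw (word α) u x‖) := by
        gcongr; exact norm_hatS_le _ ξ
    _ ≤ C₁ * (C₂ * ∑ i, A i) := by gcongr
    _ = _ := by ring

/-- The bound for u uses (4)(b) with α = 0 only; the bound for û uses (4)(a) for the finitely many β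
in {0, (n+1)e_j}. -/
lemma fam3_dominated (hω : IsWeight ω) (n : ℕ) : DominatedOn (Sch n) (Fam3 n ω) (Fam4 n ω) := by
  apply dominatedOn_of_sum
  rintro p ⟨lam, hlam, rfl | rfl⟩
  · obtain ⟨mu, C, hmu, hC, h⟩ := exp_le_mono_mul_yf hω n hlam
    refine ⟨Unit, inferInstance, fun _ u => ⨆ (β : Fin n → ℕ) (x : E n),
      ‖mulMono β (D 0 u) x‖ₑ * youngFactor ω mu (len β), C,
      fun _ => ⟨mu, hmu, Or.inr ⟨0, rfl⟩⟩, hC, fun u _ hfin => expSup_le fun x => ?_⟩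
    simp only [Fintype.sum_unique]
    obtain ⟨α, hα⟩ := h x
    have h1 : ‖mulMono α u x‖ * yf ω mu (len α) ≤ _ :=
      (ENNReal.ofReal_le_iff_le_toReal (hfin ())).1 (by
        rw [← enorm_mul_youngFactor hmu]
        simp only [D_zero]
        exact le_iSup_of_le α (le_iSup_of_le x le_rfl))
    calc _ ≤ C * (|mono α x| * yf ω mu (len α)) * ‖u x‖ := by gcongr
      _ = C * (‖mulMono α u x‖ * yf ω mu (len α)) := by
          rw [mulMono, norm_mul, Complex.norm_real, Real.norm_eq_abs]; ring
      _ ≤ _ := by gcongr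
  · obtain ⟨mu, C, hmu, hC, h⟩ := expBound_hatS_of_sup hω n hlam
    refine ⟨Option (Fin n), inferInstance, fun i u => ⨆ (α : Fin n → ℕ) (x : E n),
      ‖mulMono (pureIndex (n + 1) i) (D α u) x‖ₑ * youngFactor ω mu (len α), C,
      fun i => ⟨mu, hmu, Or.inl ⟨_, rfl⟩⟩, hC, ?_⟩
    rintro _ ⟨u, rfl⟩ hfin
    simp only [← coe_hatS]
    refine expSup_le (h u _ fun i α x => ?_)
    refine (ENNReal.ofReal_le_iff_le_toReal (hfin i)).1 ?_
    rw [← enorm_mul_youngFactor hmu]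
    exact le_iSup_of_le α (le_iSup_of_le x le_rfl)

/-- All the families are equivalent to the third one on the Schwartz functions. -/
lemma fam_equiv_fam3 (hω : IsWeight ω) (n : ℕ) (i : Fin 6) :
    DominatedOn (Sch n) (Fam n ω i) (Fam3 n ω) ∧ DominatedOn (Sch n) (Fam3 n ω) (Fam n ω i) := by
  have h34 := fam3_dominated hω n
  have h45 := fam4_dominated (n := n) hω (Sch n)
  have h53 := fam5_dominated hω n
  have h35 := h34.trans h45
  fin_cases i
  · exact ⟨fam1_dominated hω n, dominatedOn_of_subset fam3_subset_fam1⟩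
  · exact ⟨fam2_dominated hω n, dominatedOn_of_subset fam3_subset_fam2⟩
  · exact ⟨DominatedOn.refl _ _, DominatedOn.refl _ _⟩
  · exact ⟨h45.trans h53, h34⟩
  · exact ⟨h53, h35⟩
  · exact ⟨(fam6_dominated hω _).trans h53, h35.trans (fam5_dominated_fam6 _)⟩

lemma fam_dominated (hω : IsWeight ω) (n : ℕ) (i j : Fin 6) :
    DominatedOn (Sch n) (Fam n ω i) (Fam n ω j) :=
  (fam_equiv_fam3 hω n i).1.trans (fam_equiv_fam3 hω n j).2

/-! ### From domination to finiteness of the seminorms -/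

lemma DominatedOn.finite {S : Set (E n → ℂ)} {P Q : Set ((E n → ℂ) → ℝ≥0∞)}
    (h : DominatedOn S P Q) {u : E n → ℂ} (hu : u ∈ S) (hQ : ∀ q ∈ Q, q u < ∞) :
    ∀ p ∈ P, p u < ∞ := by
  intro p hp
  obtain ⟨T, hT, C, hC⟩ := h p hp
  refine (hC u hu).trans_lt (ENNReal.mul_lt_top ENNReal.coe_lt_top ?_)
  exact (Finset.sup_lt_iff ENNReal.zero_lt_top).2 fun q hq => hQ q (hT hq)

lemma exists_ofReal_bound_iff {ι : Type*} (f : ι → ℝ≥0∞) :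
    (∃ C : ℝ, 0 < C ∧ ∀ i, f i ≤ ENNReal.ofReal C) ↔ ⨆ i, f i < ∞ := by
  constructor
  · rintro ⟨C, -, h⟩
    exact (iSup_le h).trans_lt ENNReal.ofReal_lt_top
  · intro h
    refine ⟨(⨆ i, f i).toReal + 1, by positivity, fun i => (le_iSup f i).trans ?_⟩
    rw [← ENNReal.ofReal_toReal h.ne]
    apply ENNReal.ofReal_le_ofReal
    rw [ENNReal.toReal_ofReal ENNReal.toReal_nonneg]
    simp

lemma exists_ofReal_bound_iff₂ {ι κ : Type*} (f : ι → κ → ℝ≥0∞) :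
    (∃ C : ℝ, 0 < C ∧ ∀ i j, f i j ≤ ENNReal.ofReal C) ↔ ⨆ (i) (j), f i j < ∞ := by
  simpa only [iSup_prod, Prod.forall] using
    exists_ofReal_bound_iff fun p : ι × κ => f p.1 p.2

lemma cond1_iff (u : E n → ℂ) : Cond1 ω u ↔ ∀ p ∈ Fam1 n ω, p u < ∞ := by
  constructor
  · rintro ⟨h1, h2⟩ p ⟨lam, hlam, α, rfl | rfl⟩
    exacts [h1 lam hlam α, h2 lam hlam α]
  · intro h
    exact ⟨fun lam hlam α => h _ ⟨lam, hlam, α, Or.inl rfl⟩,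
      fun lam hlam α => h _ ⟨lam, hlam, α, Or.inr rfl⟩⟩

lemma cond2_iff (u : E n → ℂ) : Cond2 ω u ↔ ∀ p ∈ Fam2 n ω, p u < ∞ := by
  constructor
  · rintro ⟨h1, h2⟩ p ⟨lam, hlam, α, rfl | rfl⟩
    exacts [h1 lam hlam α, h2 lam hlam α]
  · intro h
    exact ⟨fun lam hlam α => h _ ⟨lam, hlam, α, Or.inl rfl⟩,
      fun lam hlam α => h _ ⟨lam, hlam, α, Or.inr rfl⟩⟩

lemma cond3_iff (u : E n → ℂ) : Cond3 ω u ↔ ∀ p ∈ Fam3 n ω, p u < ∞ := by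
  constructor
  · rintro ⟨h1, h2⟩ p ⟨lam, hlam, rfl | rfl⟩
    exacts [h1 lam hlam, h2 lam hlam]
  · intro h
    exact ⟨fun lam hlam => h _ ⟨lam, hlam, Or.inl rfl⟩,
      fun lam hlam => h _ ⟨lam, hlam, Or.inr rfl⟩⟩

lemma cond4_iff (u : E n → ℂ) : Cond4 ω u ↔ ∀ p ∈ Fam4 n ω, p u < ∞ := by
  simp only [Cond4, exists_ofReal_bound_iff]
  constructor
  · rintro ⟨h1, h2⟩ p ⟨lam, hlam, ⟨β, rfl⟩ | ⟨α, rfl⟩⟩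
    exacts [h1 β lam hlam, h2 α lam hlam]
  · intro h
    exact ⟨fun β lam hlam => h _ ⟨lam, hlam, Or.inl ⟨β, rfl⟩⟩,
      fun α lam hlam => h _ ⟨lam, hlam, Or.inr ⟨α, rfl⟩⟩⟩

lemma cond5_iff (u : E n → ℂ) : Cond5 ω u ↔ ∀ p ∈ Fam5 n ω, p u < ∞ := by
  simp only [Cond5, exists_ofReal_bound_iff₂]
  constructor
  · rintro h p ⟨mu, lam, hmu, hlam, rfl⟩
    exact h mu lam hmu hlam
  · intro h mu lam hmu hlam
    exact h _ ⟨mu, lam, hmu, hlam, rfl⟩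

lemma cond6_iff (u : E n → ℂ) : Cond6 ω u ↔ ∀ p ∈ Fam6 n ω, p u < ∞ := by
  simp only [Cond6, exists_ofReal_bound_iff₂]
  constructor
  · rintro h p ⟨lam, hlam, rfl⟩
    exact h lam hlam
  · intro h lam hlam
    exact h _ ⟨lam, hlam, rfl⟩

lemma mem_Space_iff (u : 𝓢(E n, ℂ)) : (u : E n → ℂ) ∈ Space n ω ↔ Cond1 ω (u : E n → ℂ) := by
  constructor
  · rintro ⟨-, -, -, h⟩
    exact h
  · intro h
    refine ⟨u.integrable, u.smooth ⊤, ?_, h⟩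
    rw [← coe_hatS]
    exact (hatS u).smooth ⊤

lemma Space_subset_Sch (hω : IsWeight ω) : Space n ω ⊆ Sch n := fun _ hu =>
  exists_schwartz hω hu

lemma finite_iff_finite (hω : IsWeight ω) (u : 𝓢(E n, ℂ)) (i j : Fin 6) :
    (∀ p ∈ Fam n ω i, p u < ∞) ↔ ∀ p ∈ Fam n ω j, p u < ∞ :=
  ⟨(fam_dominated hω n j i).finite ⟨u, rfl⟩, (fam_dominated hω n i j).finite ⟨u, rfl⟩⟩

end Equivalence

end SOmega
end

theorem mainTheorem3 (n : ℕ) (ω : ℝ → ℝ) (hω : SOmega.IsWeight ω) :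
    (∀ u : 𝓢(SOmega.E n, ℂ),
      List.TFAE [(u : SOmega.E n → ℂ) ∈ SOmega.Space n ω,
        SOmega.Cond1 ω (u : SOmega.E n → ℂ),
        SOmega.Cond2 ω (u : SOmega.E n → ℂ),
        SOmega.Cond3 ω (u : SOmega.E n → ℂ),
        SOmega.Cond4 ω (u : SOmega.E n → ℂ),
        SOmega.Cond5 ω (u : SOmega.E n → ℂ),
        SOmega.Cond6 ω (u : SOmega.E n → ℂ)]) ∧
    (∀ i : Fin 6, ∀ p ∈ SOmega.Fam n ω i, ∀ u ∈ SOmega.Space n ω, p u < ∞) ∧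
    (∀ i j : Fin 6, SOmega.DominatedOn (SOmega.Space n ω) (SOmega.Fam n ω i)
      (SOmega.Fam n ω j)) := by
  refine ⟨fun u => ?_, fun i p hp u hu => ?_, fun i j =>
    (SOmega.fam_dominated hω n i j).mono_set (SOmega.Space_subset_Sch hω)⟩
  · have h := SOmega.finite_iff_finite hω u
    rw [SOmega.cond1_iff, SOmega.cond2_iff, SOmega.cond3_iff, SOmega.cond4_iff, SOmega.cond5_iff,
      SOmega.cond6_iff]
    tfae_have 1 ↔ 2 := (SOmega.mem_Space_iff u).trans (SOmega.cond1_iff _)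
    tfae_have 2 ↔ 3 := h 0 1
    tfae_have 3 ↔ 4 := h 1 2
    tfae_have 4 ↔ 5 := h 2 3
    tfae_have 5 ↔ 6 := h 3 4
    tfae_have 6 ↔ 7 := h 4 5
    tfae_finish
  · have hc : SOmega.Cond1 ω u := hu.2.2.2
    exact (SOmega.fam_dominated hω n i 0).finite (SOmega.Space_subset_Sch hω hu)
      ((SOmega.cond1_iff u).1 hc) p hp
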